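/- For every $a\in\mathbb C$ the Chazy equation $y'''-2yy''+3y'^2=0$ has exactly one solution, for $\operatorname{Re}x$ sufficiently negative, of the form $y=u'/(2u)$ with $u(x)=e^x(1+e^xw(e^x))$, where $w$ is analytic near $0$ and $w(0)=a$ (existence, and uniqueness of the germ of $w$ at $0$). Let $a\ne 0$. Then there is a real $L$ such that this solution extends to a holomorphic solution $y$ on $\{\operatorname{Re}x<L\}$ with the line $\operatorname{Re}x=L$ as natural boundary (there is no analytic continuation to a neighbourhood of any of its points). Fix $x_0$ with $\operatorname{Re}x_0<L$. For $\varepsilon$ real, apply the action $$y(x)\mapsto \frac{\alpha\delta-\beta\gamma}{(\gamma x+\delta)^2}\,y\Big(\frac{\alpha x+\beta}{\gamma x+\delta}\Big)-\frac{6\gamma}{\gamma x+\delta}$$ with the homography $x\mapsto x_0+\varepsilon x/(x-i\varepsilon)$, and put $$y(x;\varepsilon)=-\frac{6}{x-i\varepsilon}-\frac{i\varepsilon^2}{(x-i\varepsilon)^2}\,y\Big(x_0+\frac{\varepsilon x}{x-i\varepsilon}\Big).$$ Then: 1. $y(x;0)=-6/x$, and $y(x;\varepsilon)\to-6/x$ as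 $\varepsilon\to0$, uniformly on $\{|x|\ge\delta\}$ for every $\delta>0$. 2. For all small $\varepsilon\neq0$ there is a circle $\Gamma_\varepsilon$ through $i\varepsilon$, whose centre and radius tend to $0$ as $\varepsilon\to0$, such that $0$ lies outside $\Gamma_\varepsilon$, $y(\cdot;\varepsilon)$ is a holomorphic solution of the Chazy equation outside $\Gamma_\varepsilon$ (the homography maps the exterior into $\{\operatorname{Re}x<L\}$), and $\Gamma_\varepsilon$ is a natural boundary of $y(\cdot;\varepsilon)$. 3. (Asymptotics at the boundary.) With $X=x-i\varepsilon$ and $A=-i\varepsilon^2/2$ one has, everywhere outside $\Gamma_\varepsilon$, a convergent expansion $$y(x;\varepsilon)=-\frac6X+\frac{A}{X^2}\Big(1+\sum_{n\ge1}k_n e^{-2nA/X}\Big),\qquad k_1=a\,e^{x_0+\varepsilon},$$ and, for every $\delta>0$, as $x$ tends to the boundary point $i\varepsilon$ in the sector $\operatorname{Re}(2A/X)>\delta\,|2A/X|$, $$y(x;\varepsilon)=-\frac6X+\frac{A}{X^2}\big(1+k_1e^{-2A/X}\big)+O\big(X^{-2}e^{-4A/X}\big).$$ 4. The limits $\varepsilon\to0$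 and $x\to0$ do not commute. For every $\delta>0$ and all small $\varepsilon\ne0$, no holomorphic function on the disk $\{|x|<\delta\}$ coincides with $y(\cdot;\varepsilon)$ at the points of the disk where $y(\cdot;\varepsilon)$ is defined; moreover $\lim_{\varepsilon\to0}x\,y(x;\varepsilon)=-6$ for each $x\neq0$, whereas $\lim_{x\to0}x\,y(x;\varepsilon)=0$ for each small $\varepsilon\ne0$. -/

import Mathlib

open Filter Topology Metric Set

/-- `y` is a holomorphic solution of the Chazy equation `y''' - 2 y y'' + 3 y'^2 = 0` on the
open set `U`. -/
def IsChazySolutionOn (y : ℂ → ℂ) (U : Set ℂ) : Prop :=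
  IsOpen U ∧ DifferentiableOn ℂ y U ∧
    ∀ x ∈ U, iteratedDeriv 3 y x - 2 * y x * iteratedDeriv 2 y x + 3 * (deriv y x) ^ 2 = 0

/-- The function `u(x) = e^x (1 + e^x w(e^x))`. -/
noncomputable def expU (w : ℂ → ℂ) (x : ℂ) : ℂ :=
  Complex.exp x * (1 + Complex.exp x * w (Complex.exp x))

/-- The function `y = u' / (2u)`. -/
noncomputable def halfLogDeriv (u : ℂ → ℂ) (x : ℂ) : ℂ :=
  deriv u x / (2 * u x)

/-- `w` is analytic near `0`, `w(0) = a`, and with `u(x) = e^x (1 + e^x w(e^x))` the function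
`y = u' / (2u)` solves the Chazy equation for `Re x` sufficiently negative, that is, when
`e^x` is small. -/
def IsExpSolution (a : ℂ) (w : ℂ → ℂ) : Prop :=
  AnalyticAt ℂ w 0 ∧ w 0 = a ∧
    ∃ ρ : ℝ, IsChazySolutionOn (halfLogDeriv (expU w)) {x : ℂ | x.re < -ρ}

/-- The action of the homography `x ↦ (a x + b) / (c x + d)` on functions:
`(ad - bc) / (cx + d)^2 * y((ax + b) / (cx + d)) - 6c / (cx + d)`. -/
noncomputable def sl2Act (a b c d : ℂ) (y : ℂ → ℂ) (x : ℂ) : ℂ :=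
  (a * d - b * c) / (c * x + d) ^ 2 * y ((a * x + b) / (c * x + d)) - 6 * c / (c * x + d)

/-- The one-parameter family obtained from `y` by the homographies
`x ↦ x₀ + ε x / (x - i ε) = ((x₀ + ε) x - i ε x₀) / (x - i ε)`. -/
noncomputable def perturbedFamily (x₀ : ℂ) (y : ℂ → ℂ) (ε : ℝ) (x : ℂ) : ℂ :=
  sl2Act (x₀ + ε) (-(Complex.I * ε * x₀)) 1 (-(Complex.I * ε)) y x

/-- `Γ` is a natural boundary of `f`: `f` is holomorphic on the open set `Ω`, `Γ` is part of the
boundary of `Ω`, and at no point `p` of `Γ` is there a function analytic at `p` which coincides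
with `f` at the points of `Ω` near `p`. -/
def IsNaturalBoundary (f : ℂ → ℂ) (Ω Γ : Set ℂ) : Prop :=
  IsOpen Ω ∧ DifferentiableOn ℂ f Ω ∧ Γ ⊆ frontier Ω ∧
    ∀ p ∈ Γ, ¬ ∃ g : ℂ → ℂ, AnalyticAt ℂ g p ∧ ∀ᶠ x in 𝓝[Ω] p, g x = f x

/-- The parameter `A = -i ε² / 2` of the solution `-6/X + A/X²` about which the member of the
family with parameter `ε` is expanded in powers of `exp(-2A/X)`, where `X = x - i ε`. -/
noncomputable def expansionParam (ε : ℝ) : ℂ :=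
  -(Complex.I * (ε : ℂ) ^ 2 / 2)

/-- The sector `δ |2A/X| < Re (2A/X)` with vertex `i ε`, `X = x - i ε`, in which `exp(-2A/X)` is
exponentially small. For `0 < δ < 1` its opening `2 arccos δ` is less than `π`, and every such
opening occurs. -/
def expSector (ε δ : ℝ) : Set ℂ :=
  {x : ℂ | δ * ‖2 * expansionParam ε / (x - Complex.I * ε)‖ <
    (2 * expansionParam ε / (x - Complex.I * ε)).re}

/-! Everything is drawn from one solution, π i E₂(τ) on the upper half-plane, and from the
covariance of the Chazy operator (`chazyOp_sl2Act`): under `sl2Act` it is multiplied by the fourth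
power of the derivative of the homography. So solutions go to solutions, and boundary points without
continuation go to such points.

Quasi-modularity of E₂ says exactly that `eisChazy` is invariant under SL₂(ℤ). Its Chazy expression
is then modular of weight 8 and vanishes at the cusps; there is no nonzero cusp form of weight below
12, so it is zero. The same invariance makes the real line a natural boundary: a continuation
bounded near a rational point would force the limit 0 at i∞, where the limit is π i.

In q = e^x, the difference of two solutions with value 1/2 at q = 0 has an order n of vanishing with
n²(n - 1) = 0, so the first derivative at 0 determines the solution (`eulerChazyOp_unique`). Hence
u'/(2u) = E₂(b e^x)/2, E₂ being read as a series in q, with b = -a/24, and w follows by integrating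
u'/u. For a ≠ 0 this is a transform of π i E₂, with natural boundary Re x = -log |b|.

The homography of the family is x₀ + ε - 2A/X. The preimage of the half-plane is the exterior of a
circle through its pole iε, and the expansion in exp(-2A/X) is the q-series of E₂. The circle
shrinks to 0 while 0 remains outside it, which is why the limits do not commute. -/

/-- The left-hand side of the Chazy equation. -/
noncomputable def chazyOp (y : ℂ → ℂ) (x : ℂ) : ℂ :=
  iteratedDeriv 3 y x - 2 * y x * iteratedDeriv 2 y x + 3 * (deriv y x) ^ 2

/-- The operator `q d/dq`. -/
noncomputable def eulerDeriv (F : ℂ → ℂ) (q : ℂ) : ℂ := q * deriv F q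

/-- The left-hand side of the Chazy equation in the variable `q = e^x`. -/
noncomputable def eulerChazyOp (F : ℂ → ℂ) (q : ℂ) : ℂ :=
  eulerDeriv (eulerDeriv (eulerDeriv F)) q - 2 * F q * eulerDeriv (eulerDeriv F) q +
    3 * eulerDeriv F q ^ 2

/-! ### The Chazy operator in the variables x and q = e^x. -/

theorem isChazySolutionOn_iff {y : ℂ → ℂ} {U : Set ℂ} : IsChazySolutionOn y U ↔
    IsOpen U ∧ DifferentiableOn ℂ y U ∧ ∀ x ∈ U, chazyOp y x = 0 := Iff.rfl

theorem chazyOp_eq_of_hasDerivAt {f f₁ f₂ f₃ : ℂ → ℂ} {V : Set ℂ} (hV : IsOpen V)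
    (h₁ : ∀ x ∈ V, HasDerivAt f (f₁ x) x) (h₂ : ∀ x ∈ V, HasDerivAt f₁ (f₂ x) x)
    (h₃ : ∀ x ∈ V, HasDerivAt f₂ (f₃ x) x) {x : ℂ} (hx : x ∈ V) :
    chazyOp f x = f₃ x - 2 * f x * f₂ x + 3 * f₁ x ^ 2 := by
  have e₁ : EqOn (deriv f) f₁ V := fun x hx => (h₁ x hx).deriv
  have e₂ : EqOn (deriv (deriv f)) f₂ V := fun x hx => by
    rw [(e₁.eventuallyEq_of_mem (hV.mem_nhds hx)).deriv_eq, (h₂ x hx).deriv]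
  have e₃ : EqOn (deriv (deriv (deriv f))) f₃ V := fun x hx => by
    rw [(e₂.eventuallyEq_of_mem (hV.mem_nhds hx)).deriv_eq, (h₃ x hx).deriv]
  simp only [chazyOp, iteratedDeriv_succ, iteratedDeriv_zero]
  rw [e₁ hx, e₂ hx, e₃ hx]

theorem chazyOp_congr {f g : ℂ → ℂ} {x : ℂ} (h : f =ᶠ[𝓝 x] g) : chazyOp f x = chazyOp g x := by
  simp only [chazyOp, h.iteratedDeriv_eq, h.deriv_eq, h.eq_of_nhds]

theorem eulerDeriv_congr {F G : ℂ → ℂ} {q : ℂ} (h : F =ᶠ[𝓝 q] G) :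
    eulerDeriv F =ᶠ[𝓝 q] eulerDeriv G := by
  filter_upwards [h.deriv] with z hz
  simp only [eulerDeriv, hz]

theorem eulerDeriv_comp_const_mul (F : ℂ → ℂ) (b : ℂ) :
    eulerDeriv (fun q => F (b * q)) = fun q => eulerDeriv F (b * q) := by
  funext q
  simp only [eulerDeriv, deriv_comp_mul_left, smul_eq_mul]
  ring

theorem eulerChazyOp_comp_const_mul (F : ℂ → ℂ) (b q : ℂ) :
    eulerChazyOp (fun q => F (b * q)) q = eulerChazyOp F (b * q) := by
  simp only [eulerChazyOp, eulerDeriv_comp_const_mul]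

theorem DifferentiableOn.eulerDeriv {F : ℂ → ℂ} {U : Set ℂ} (hF : DifferentiableOn ℂ F U)
    (hU : IsOpen U) : DifferentiableOn ℂ (eulerDeriv F) U :=
  differentiableOn_id.mul (hF.deriv hU)

theorem AnalyticAt.eulerDeriv {F : ℂ → ℂ} {q : ℂ} (hF : AnalyticAt ℂ F q) :
    AnalyticAt ℂ (eulerDeriv F) q := analyticAt_id.mul hF.deriv

theorem chazyOp_comp_exp {F : ℂ → ℂ} {U : Set ℂ} (hU : IsOpen U) (hF : DifferentiableOn ℂ F U)
    {x : ℂ} (hx : Complex.exp x ∈ U) :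
    chazyOp (fun x => F (Complex.exp x)) x = eulerChazyOp F (Complex.exp x) := by
  have key : ∀ G : ℂ → ℂ, DifferentiableOn ℂ G U → ∀ x ∈ Complex.exp ⁻¹' U,
      HasDerivAt (fun x => G (Complex.exp x)) (eulerDeriv G (Complex.exp x)) x := by
    intro G hG x hx
    have := ((hG.differentiableAt (hU.mem_nhds hx)).hasDerivAt).comp x (Complex.hasDerivAt_exp x)
    exact this.congr_deriv (mul_comm _ _)
  exact chazyOp_eq_of_hasDerivAt (hU.preimage Complex.continuous_exp) (key F hF)
    (key _ (hF.eulerDeriv hU)) (key _ ((hF.eulerDeriv hU).eulerDeriv hU)) hx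

/-! ### Covariance under homographies. -/

theorem hasDerivAt_homography (a b c d : ℂ) {x : ℂ} (hx : c * x + d ≠ 0) :
    HasDerivAt (fun x => (a * x + b) / (c * x + d)) ((a * d - b * c) / (c * x + d) ^ 2) x := by
  have h₁ : HasDerivAt (fun x => a * x + b) a x := by
    simpa using ((hasDerivAt_id x).const_mul a).add_const b
  have h₂ : HasDerivAt (fun x => c * x + d) c x := by
    simpa using ((hasDerivAt_id x).const_mul c).add_const d
  exact (h₁.div h₂ hx).congr_deriv (by ring)

theorem hasDerivAt_inv_linear_pow (c d : ℂ) (n : ℕ) {x : ℂ} (hx : c * x + d ≠ 0) :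
    HasDerivAt (fun x => ((c * x + d)⁻¹) ^ n) (-(n * c) * ((c * x + d)⁻¹) ^ (n + 1)) x := by
  have h₂ : HasDerivAt (fun x => c * x + d) c x := by
    simpa using ((hasDerivAt_id x).const_mul c).add_const d
  refine ((h₂.inv hx).pow n).congr_deriv ?_
  cases n with
  | zero => simp
  | succ n =>
    simp only [Pi.inv_apply, Nat.add_sub_cancel, div_eq_mul_inv, ← inv_pow]
    ring

theorem isOpen_homography_preimage (a b c d : ℂ) {U : Set ℂ} (hU : IsOpen U) :
    IsOpen {x | c * x + d ≠ 0 ∧ (a * x + b) / (c * x + d) ∈ U} := by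
  rw [isOpen_iff_mem_nhds]
  rintro x ⟨h₁, h₂⟩
  have hc : ContinuousAt (fun x => c * x + d) x := by fun_prop
  exact (hc.eventually_ne h₁).and
    ((hasDerivAt_homography a b c d h₁).continuousAt.eventually_mem (hU.mem_nhds h₂))

theorem differentiableOn_sl2Act (a b c d : ℂ) {y : ℂ → ℂ} {U : Set ℂ} (hU : IsOpen U)
    (hy : DifferentiableOn ℂ y U) :
    DifferentiableOn ℂ (sl2Act a b c d y)
      {x | c * x + d ≠ 0 ∧ (a * x + b) / (c * x + d) ∈ U} := by
  rintro x ⟨h₁, h₂⟩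
  have hg := hasDerivAt_homography a b c d h₁
  have hyg : DifferentiableAt ℂ (fun x => y ((a * x + b) / (c * x + d))) x :=
    (hy.differentiableAt (hU.mem_nhds h₂)).comp x hg.differentiableAt
  have hl : DifferentiableAt ℂ (fun x : ℂ => c * x + d) x := by fun_prop
  exact ((((differentiableAt_const _).div (hl.pow 2) (pow_ne_zero 2 h₁)).mul hyg).sub
    ((differentiableAt_const _).div hl h₁)).differentiableWithinAt

/-- The inhomogeneous term -6c/(cx + d) and the coefficients -2 and 3 are matched so that all terms
of lower weight cancel, leaving a quantity of weight 8. -/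
theorem chazyOp_sl2Act (a b c d : ℂ) {y : ℂ → ℂ} {U : Set ℂ} (hU : IsOpen U)
    (hy : DifferentiableOn ℂ y U) {x : ℂ} (hx : c * x + d ≠ 0)
    (hxU : (a * x + b) / (c * x + d) ∈ U) :
    chazyOp (sl2Act a b c d y) x =
      ((a * d - b * c) / (c * x + d) ^ 2) ^ 4 * chazyOp y ((a * x + b) / (c * x + d)) := by
  set D := a * d - b * c with hD
  set g : ℂ → ℂ := fun x => (a * x + b) / (c * x + d) with hgdef
  set t : ℂ → ℂ := fun x => (c * x + d)⁻¹ with htdef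
  set V := {x | c * x + d ≠ 0 ∧ g x ∈ U} with hV
  have ht : ∀ n : ℕ, ∀ x ∈ V, HasDerivAt (fun x => t x ^ n) (-(n * c) * t x ^ (n + 1)) x :=
    fun n x hx => hasDerivAt_inv_linear_pow c d n hx.1
  have hyg : ∀ f : ℂ → ℂ, DifferentiableOn ℂ f U → ∀ x ∈ V,
      HasDerivAt (fun x => f (g x)) (D * t x ^ 2 * deriv f (g x)) x := by
    intro f hf x hx
    refine (((hf.differentiableAt (hU.mem_nhds hx.2)).hasDerivAt).comp x
      (hasDerivAt_homography a b c d hx.1)).congr_deriv ?_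
    simp only [htdef, hD, hgdef, inv_pow, div_eq_mul_inv]
    ring
  have d₁ := hy.deriv hU
  have d₂ := d₁.deriv hU
  have step : ∀ (k : ℂ) (n : ℕ) (f : ℂ → ℂ), DifferentiableOn ℂ f U → ∀ x ∈ V,
      HasDerivAt (fun x => k * t x ^ n * f (g x))
        (k * (-(n * c) * t x ^ (n + 1)) * f (g x) +
          k * t x ^ n * (D * t x ^ 2 * deriv f (g x))) x :=
    fun k n f hf x hx => ((ht n x hx).const_mul k).mul (hyg f hf x hx)
  have hVo : IsOpen V := isOpen_homography_preimage a b c d hU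
  have e₀ : sl2Act a b c d y = fun x => D * t x ^ 2 * y (g x) + -(6 * c) * t x ^ 1 := by
    funext x
    simp only [sl2Act, htdef, hD, hgdef, inv_pow, div_eq_mul_inv]
    ring
  have hx' : x ∈ V := ⟨hx, hxU⟩
  -- The three derivatives in closed form, from t' = -c t² and g' = D t²; the covariance is then a
  -- polynomial identity.
  have main := chazyOp_eq_of_hasDerivAt (f := sl2Act a b c d y)
    (f₁ := fun x => D ^ 2 * t x ^ 4 * deriv y (g x) + -(2 * c * D) * t x ^ 3 * y (g x) +
      6 * c ^ 2 * t x ^ 2)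
    (f₂ := fun x => D ^ 3 * t x ^ 6 * deriv (deriv y) (g x) +
      -(6 * c * D ^ 2) * t x ^ 5 * deriv y (g x) + 6 * c ^ 2 * D * t x ^ 4 * y (g x) +
      -(12 * c ^ 3) * t x ^ 3)
    (f₃ := fun x => D ^ 4 * t x ^ 8 * deriv (deriv (deriv y)) (g x) +
      -(12 * c * D ^ 3) * t x ^ 7 * deriv (deriv y) (g x) +
      36 * c ^ 2 * D ^ 2 * t x ^ 6 * deriv y (g x) + -(24 * c ^ 3 * D) * t x ^ 5 * y (g x) +
      36 * c ^ 4 * t x ^ 4) hVo ?_ ?_ ?_ hx'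
  · rw [main, e₀]
    simp only [chazyOp, iteratedDeriv_succ, iteratedDeriv_zero]
    have : D / (c * x + d) ^ 2 = D * t x ^ 2 := by
      simp only [htdef, inv_pow, div_eq_mul_inv]
    rw [this]
    ring
  · intro x hx
    rw [e₀]
    refine ((step _ 2 y hy x hx).add ((ht 1 x hx).const_mul _)).congr_deriv ?_
    push_cast
    ring
  · intro x hx
    refine (((step _ 4 _ d₁ x hx).add (step _ 3 y hy x hx)).add
      ((ht 2 x hx).const_mul _)).congr_deriv ?_
    push_cast
    ring
  · intro x hx
    refine ((((step _ 6 _ d₂ x hx).add (step _ 5 _ d₁ x hx)).add (step _ 4 y hy x hx)).add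
      ((ht 3 x hx).const_mul _)).congr_deriv ?_
    push_cast
    ring

theorem IsChazySolutionOn.sl2Act (a b c d : ℂ) {y : ℂ → ℂ} {U : Set ℂ}
    (hy : IsChazySolutionOn y U) :
    IsChazySolutionOn (sl2Act a b c d y)
      {x | c * x + d ≠ 0 ∧ (a * x + b) / (c * x + d) ∈ U} := by
  obtain ⟨hU, hd, h0⟩ := hy
  refine ⟨isOpen_homography_preimage a b c d hU, differentiableOn_sl2Act a b c d hU hd, ?_⟩
  rintro x ⟨h₁, h₂⟩
  exact (chazyOp_sl2Act a b c d hU hd h₁ h₂).trans (by rw [chazyOp, h0 _ h₂, mul_zero])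

/-- No function analytic at `p` coincides with `f` at the points of `Ω` near `p`. -/
def IsSingularBoundaryPoint (f : ℂ → ℂ) (Ω : Set ℂ) (p : ℂ) : Prop :=
  ¬ ∃ g : ℂ → ℂ, AnalyticAt ℂ g p ∧ ∀ᶠ x in 𝓝[Ω] p, g x = f x

/-- A continuation of the transform at p, pulled back by the inverse homography `k` and solved for
y, would continue y at the image of p. -/
theorem IsSingularBoundaryPoint.sl2Act {a b c d : ℂ} (hD : a * d - b * c ≠ 0) {y : ℂ → ℂ}
    {U : Set ℂ} {p : ℂ} (hp : c * p + d ≠ 0)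
    (h : IsSingularBoundaryPoint y U ((a * p + b) / (c * p + d))) :
    IsSingularBoundaryPoint (sl2Act a b c d y)
      {x | c * x + d ≠ 0 ∧ (a * x + b) / (c * x + d) ∈ U} p := by
  rintro ⟨G, hG, hGe⟩
  refine h ?_
  set P := (a * p + b) / (c * p + d) with hP
  set k : ℂ → ℂ := fun z => (d * z - b) / (-c * z + a) with hk
  have hden : -c * P + a ≠ 0 := by
    have : -c * P + a = (a * d - b * c) / (c * p + d) := by
      rw [hP]; field_simp; ring
    rw [this]
    exact div_ne_zero hD hp
  have hkP : k P = p := by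
    rw [hk]
    simp only
    have hPm : P * (c * p + d) = a * p + b := by rw [hP, div_mul_cancel₀ _ hp]
    rw [div_eq_iff hden]
    linear_combination hPm
  have hka : AnalyticAt ℂ k P := by
    refine AnalyticAt.div ?_ ?_ hden <;> fun_prop
  have hGk : AnalyticAt ℂ (fun z => G (k z)) P := by
    refine AnalyticAt.comp (g := G) ?_ hka
    rwa [hkP]
  have hsk : AnalyticAt ℂ (fun z => c * k z + d) P := by fun_prop
  have hsk0 : c * k P + d ≠ 0 := by rwa [hkP]
  refine ⟨fun z => (G (k z) + 6 * c / (c * k z + d)) * (c * k z + d) ^ 2 / (a * d - b * c), ?_, ?_⟩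
  · exact ((hGk.add (analyticAt_const.div hsk hsk0)).mul (hsk.pow 2)).div analyticAt_const hD
  · have e₁ : ∀ᶠ z in 𝓝 P, -c * z + a ≠ 0 :=
      ContinuousAt.eventually_ne (by fun_prop) hden
    have e₂ : ∀ᶠ z in 𝓝 P, c * k z + d ≠ 0 := hsk.continuousAt.eventually_ne hsk0
    have hinv : ∀ᶠ z in 𝓝 P, (a * k z + b) / (c * k z + d) = z := by
      filter_upwards [e₁, e₂] with z h₁ h₂
      rw [div_eq_iff h₂]
      simp only [hk]
      rw [mul_div_assoc', div_add' _ _ _ h₁, mul_div_assoc', div_add' _ _ _ h₁, mul_div_assoc']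
      congr 1
      ring
    have hE := eventually_nhdsWithin_iff.1 hGe
    have hE' : ∀ᶠ z in 𝓝 P, k z ∈ {x | c * x + d ≠ 0 ∧ (a * x + b) / (c * x + d) ∈ U} →
        G (k z) = _root_.sl2Act a b c d y (k z) := by
      have : Tendsto k (𝓝 P) (𝓝 p) := by simpa [hkP] using hka.continuousAt.tendsto
      exact this.eventually hE
    rw [eventually_nhdsWithin_iff]
    filter_upwards [hE', e₂, hinv] with z h₁ h₂ h₃ hz
    rw [h₁ ⟨h₂, by rwa [h₃]⟩]
    simp only [_root_.sl2Act, h₃]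
    field_simp
    ring

/-! ### The q-series of E₂ and the SL₂(ℤ)-invariance of π i E₂. -/

open EisensteinSeries UpperHalfPlane in
theorem E2_comp_ofComplex_periodic :
    Function.Periodic (EisensteinSeries.E2 ∘ UpperHalfPlane.ofComplex) (1 : ℝ) := by
  intro w
  rcases lt_or_ge 0 w.im with hw | hw
  · have hw' : 0 < (w + (1 : ℝ)).im := by simpa using hw
    simp only [Function.comp_apply, ofComplex_apply_of_im_pos hw, ofComplex_apply_of_im_pos hw']
    refine (hasSum_qExpansion_E2 (z := ⟨_, hw'⟩)).unique ?_
    convert hasSum_qExpansion_E2 (z := ⟨w, hw⟩) using 4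
    simp [mul_add, Complex.exp_add, Complex.exp_two_pi_mul_I]
  -- Outside the upper half-plane `ofComplex` takes a constant default value, so periodicity holds
  -- on all of ℂ.
  · have hw' : (w + (1 : ℝ)).im ≤ 0 := by simpa using hw
    simp only [Function.comp_apply, ofComplex_apply_of_im_nonpos hw,
      ofComplex_apply_of_im_nonpos hw']

/-- The coefficients of the `q`-expansion of the Eisenstein series `E₂`. -/
noncomputable def eisCoeff (m : ℕ) : ℂ := if m = 0 then 1 else -24 * ArithmeticFunction.sigma 1 m

/-- The Eisenstein series `E₂` as a function of `q`. -/
noncomputable def eisQ : ℂ → ℂ := UpperHalfPlane.cuspFunction 1 EisensteinSeries.E2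

/-- The solution `π i E₂` of the Chazy equation. -/
noncomputable def eisChazy (τ : ℂ) : ℂ :=
  Real.pi * Complex.I * EisensteinSeries.E2 (UpperHalfPlane.ofComplex τ)

open EisensteinSeries UpperHalfPlane in
theorem hasFPowerSeriesOnBall_eisQ :
    HasFPowerSeriesOnBall eisQ (FormalMultilinearSeries.ofScalars ℂ eisCoeff) 0 1 := by
  refine hasFPowerSeriesOnBall_cuspFunction one_pos
    (analyticAt_cuspFunction_zero one_pos E2_comp_ofComplex_periodic E2_mdifferentiable
      isBoundedAtImInfty_E2) fun τ => ?_
  simpa only [eisCoeff, Function.Periodic.qParam, Complex.ofReal_one, div_one] using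
    hasSum_qExpansion_E2 (z := τ)

theorem differentiableOn_eisQ : DifferentiableOn ℂ eisQ (ball 0 1) := by
  have := hasFPowerSeriesOnBall_eisQ.differentiableOn
  rwa [← ENNReal.ofReal_one, eball_ofReal] at this

theorem hasSum_eisQ {q : ℂ} (hq : ‖q‖ < 1) : HasSum (fun m => eisCoeff m * q ^ m) (eisQ q) := by
  have := hasFPowerSeriesOnBall_eisQ.hasSum (y := q) (by
    rw [← ENNReal.ofReal_one, eball_ofReal]; simpa using hq)
  simpa [FormalMultilinearSeries.ofScalars_apply_eq, mul_comm] using this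

theorem eisQ_zero : eisQ 0 = 1 := by
  have h := hasSum_eisQ (q := 0) (by simp)
  refine h.unique ?_
  convert hasSum_ite_eq 0 (1 : ℂ) using 2 with m
  by_cases hm : m = 0 <;> simp [hm, eisCoeff]

theorem deriv_eisQ_zero : deriv eisQ 0 = -24 := by
  rw [hasFPowerSeriesOnBall_eisQ.hasFPowerSeriesAt.deriv]
  simp [eisCoeff]

theorem eisChazy_eq {τ : ℂ} (hτ : 0 < τ.im) :
    eisChazy τ = Real.pi * Complex.I * eisQ (Complex.exp (2 * Real.pi * Complex.I * τ)) := by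
  have := UpperHalfPlane.eq_cuspFunction (h := 1) (f := EisensteinSeries.E2) ⟨τ, hτ⟩ one_ne_zero
    E2_comp_ofComplex_periodic
  simp only [Function.Periodic.qParam, Complex.ofReal_one, div_one] at this
  rw [eisChazy, UpperHalfPlane.ofComplex_apply_of_im_pos hτ, eisQ, this]

theorem isOpen_im_pos : IsOpen {τ : ℂ | 0 < τ.im} := isOpen_lt continuous_const Complex.continuous_im

theorem differentiableOn_eisChazy : DifferentiableOn ℂ eisChazy {τ | 0 < τ.im} :=
  (UpperHalfPlane.mdifferentiable_iff.1 E2_mdifferentiable).const_mul _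

theorem homography_eq_smul (γ : Matrix.SpecialLinearGroup (Fin 2) ℤ) (z : UpperHalfPlane) :
    ((γ • z : UpperHalfPlane) : ℂ) = ((γ 0 0 : ℂ) * z + γ 0 1) / ((γ 1 0 : ℂ) * z + γ 1 1) := by
  rw [UpperHalfPlane.coe_specialLinearGroup_apply]
  simp

theorem denom_ne_zero_of_im_pos (γ : Matrix.SpecialLinearGroup (Fin 2) ℤ) {τ : ℂ} (hτ : 0 < τ.im) :
    (γ 1 0 : ℂ) * τ + γ 1 1 ≠ 0 := by
  simpa [UpperHalfPlane.denom] using UpperHalfPlane.denom_ne_zero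
    (Matrix.SpecialLinearGroup.toGL ((Matrix.SpecialLinearGroup.map (Int.castRingHom ℝ)) γ))
    ⟨τ, hτ⟩

theorem im_homography_pos (γ : Matrix.SpecialLinearGroup (Fin 2) ℤ) {τ : ℂ} (hτ : 0 < τ.im) :
    0 < (((γ 0 0 : ℂ) * τ + γ 0 1) / ((γ 1 0 : ℂ) * τ + γ 1 1)).im := by
  have := (γ • (⟨τ, hτ⟩ : UpperHalfPlane)).im_pos
  rwa [← UpperHalfPlane.coe_im, homography_eq_smul] at this

theorem det_intCast (γ : Matrix.SpecialLinearGroup (Fin 2) ℤ) :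
    (γ 0 0 : ℂ) * γ 1 1 - γ 0 1 * γ 1 0 = 1 := by
  have := γ.det_coe
  rw [Matrix.det_fin_two] at this
  exact_mod_cast this

/-- With ζ(2) = π²/6, the correction term in the transformation of E₂, multiplied by π i, is exactly
the term -6c/(cτ + d) of the action. -/
theorem sl2Act_eisChazy (γ : Matrix.SpecialLinearGroup (Fin 2) ℤ) {τ : ℂ} (hτ : 0 < τ.im) :
    sl2Act (γ 0 0) (γ 0 1) (γ 1 0) (γ 1 1) eisChazy τ = eisChazy τ := by
  have h := congrFun (EisensteinSeries.E2_slash_action γ) ⟨τ, hτ⟩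
  have hs := denom_ne_zero_of_im_pos γ hτ
  have hm : UpperHalfPlane.ofComplex (((γ 0 0 : ℂ) * τ + γ 0 1) / ((γ 1 0 : ℂ) * τ + γ 1 1)) =
      γ • (⟨τ, hτ⟩ : UpperHalfPlane) := by
    rw [UpperHalfPlane.ofComplex_apply_of_im_pos (im_homography_pos γ hτ)]
    ext
    exact (homography_eq_smul γ ⟨τ, hτ⟩).symm
  have hd : UpperHalfPlane.denom
      (Matrix.SpecialLinearGroup.toGL ((Matrix.SpecialLinearGroup.map (Int.castRingHom ℝ)) γ)) τ =
      (γ 1 0 : ℂ) * τ + γ 1 1 := by simp [UpperHalfPlane.denom]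
  rw [ModularForm.SL_slash_apply] at h
  simp only [Pi.sub_apply, Pi.smul_apply, smul_eq_mul, EisensteinSeries.D2, riemannZeta_two] at h
  rw [hd, ← hm] at h
  rw [sl2Act, det_intCast, eisChazy, eisChazy, UpperHalfPlane.ofComplex_apply_of_im_pos hτ]
  have hpi : (Real.pi : ℂ) ≠ 0 := by exact_mod_cast Real.pi_ne_zero
  rw [zpow_neg, zpow_ofNat] at h
  generalize EisensteinSeries.E2 (UpperHalfPlane.ofComplex _) = A at *
  generalize EisensteinSeries.E2 _ = B at *
  have hB : B = A * (((γ 1 0 : ℂ) * τ + γ 1 1) ^ 2)⁻¹ + 1 / (2 * ((Real.pi : ℂ) ^ 2 / 6)) *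
    (2 * Real.pi * Complex.I * γ 1 0 / ((γ 1 0 : ℂ) * τ + γ 1 1)) := by rw [h]; ring
  rw [hB]
  field_simp
  linear_combination (-6 * (γ 1 0 : ℂ) * (γ 1 0 * τ + γ 1 1)) * Complex.I_sq

/-! ### E₂ solves the Chazy equation. -/

theorem norm_exp_lt_one_iff {x : ℂ} : ‖Complex.exp x‖ < 1 ↔ x.re < 0 := by
  rw [Complex.norm_exp, Real.exp_lt_one_iff]

theorem re_two_pi_I_mul (τ : ℂ) : (2 * Real.pi * Complex.I * τ).re = -(2 * Real.pi * τ.im) := by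
  simp

/-- π i E₂ is the transform of x ↦ `eisQ (exp x) / 2` by the scaling x = 2π i τ. This form exhibits
the behaviour at the cusp. -/
theorem chazyOp_eisChazy_eq {τ : ℂ} (hτ : 0 < τ.im) :
    chazyOp eisChazy τ = (2 * Real.pi * Complex.I) ^ 4 *
      eulerChazyOp (fun q => eisQ q / 2) (Complex.exp (2 * Real.pi * Complex.I * τ)) := by
  have hre : ∀ τ : ℂ, 0 < τ.im → (2 * Real.pi * Complex.I * τ).re < 0 := fun τ hτ => by
    rw [re_two_pi_I_mul]
    have := mul_pos Real.two_pi_pos hτ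
    linarith
  have hball : Complex.exp (2 * Real.pi * Complex.I * τ) ∈ ball (0 : ℂ) 1 := by
    rw [mem_ball_zero_iff, norm_exp_lt_one_iff]
    exact hre τ hτ
  have hQ : DifferentiableOn ℂ (fun q => eisQ q / 2) (ball 0 1) := differentiableOn_eisQ.div_const 2
  have hy : DifferentiableOn ℂ (fun x => eisQ (Complex.exp x) / 2) (Complex.exp ⁻¹' ball 0 1) :=
    hQ.comp Complex.differentiable_exp.differentiableOn fun x hx => hx
  have e : eisChazy =ᶠ[𝓝 τ]
      sl2Act (2 * Real.pi * Complex.I) 0 0 1 (fun x => eisQ (Complex.exp x) / 2) := by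
    filter_upwards [isOpen_im_pos.mem_nhds hτ] with z hz
    rw [eisChazy_eq hz]
    simp [sl2Act]
    ring
  rw [chazyOp_congr e, chazyOp_sl2Act _ _ _ _ (isOpen_ball.preimage Complex.continuous_exp) hy
    (by simp) (by simpa using hball)]
  simp only [zero_mul, zero_add, add_zero, div_one, one_pow, mul_one, sub_zero, mul_zero]
  rw [chazyOp_comp_exp isOpen_ball hQ hball]

theorem chazyOp_eisChazy_smul (γ : Matrix.SpecialLinearGroup (Fin 2) ℤ) {τ : ℂ} (hτ : 0 < τ.im) :
    chazyOp eisChazy (((γ 0 0 : ℂ) * τ + γ 0 1) / ((γ 1 0 : ℂ) * τ + γ 1 1)) *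
      (((γ 1 0 : ℂ) * τ + γ 1 1) ^ 8)⁻¹ = chazyOp eisChazy τ := by
  have e : eisChazy =ᶠ[𝓝 τ] sl2Act (γ 0 0) (γ 0 1) (γ 1 0) (γ 1 1) eisChazy := by
    filter_upwards [isOpen_im_pos.mem_nhds hτ] with z hz
    exact (sl2Act_eisChazy γ hz).symm
  rw [chazyOp_congr e, chazyOp_sl2Act _ _ _ _ isOpen_im_pos differentiableOn_eisChazy
    (denom_ne_zero_of_im_pos γ hτ) (im_homography_pos γ hτ), det_intCast, one_div, inv_pow, ← pow_mul,
    mul_comm]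

theorem differentiableOn_chazyOp {y : ℂ → ℂ} {U : Set ℂ} (hU : IsOpen U)
    (hy : DifferentiableOn ℂ y U) : DifferentiableOn ℂ (chazyOp y) U := by
  have d₁ := hy.deriv hU
  have d₂ := d₁.deriv hU
  have d₃ := d₂.deriv hU
  have e : chazyOp y = fun x => deriv (deriv (deriv y)) x - 2 * y x * deriv (deriv y) x +
      3 * (deriv y x) ^ 2 := by
    funext x
    simp only [chazyOp, iteratedDeriv_succ, iteratedDeriv_zero]
  rw [e]
  exact (d₃.sub ((hy.const_mul 2).mul d₂)).add ((d₁.pow 2).const_mul 3)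

theorem AnalyticAt.eulerChazyOp {F : ℂ → ℂ} {q : ℂ} (hF : AnalyticAt ℂ F q) :
    AnalyticAt ℂ (eulerChazyOp F) q :=
  (hF.eulerDeriv.eulerDeriv.eulerDeriv.sub
    ((analyticAt_const.mul hF).mul hF.eulerDeriv.eulerDeriv)).add
    (analyticAt_const.mul (hF.eulerDeriv.pow 2))

theorem analyticAt_eisQ_zero : AnalyticAt ℂ eisQ 0 :=
  hasFPowerSeriesOnBall_eisQ.analyticAt

open UpperHalfPlane in
/-- The Chazy expression of `π i E₂`, as a cusp form of weight `8`. -/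
noncomputable def chazyCuspForm : CuspForm (Matrix.SpecialLinearGroup.mapGL (n := Fin 2) (R := ℤ) ℝ).range 8 :=
  have slash : ∀ γ : Matrix.SpecialLinearGroup (Fin 2) ℤ,
      SlashAction.map (8 : ℤ) γ (fun z : UpperHalfPlane => chazyOp eisChazy z) =
        fun z : UpperHalfPlane => chazyOp eisChazy z := by
    intro γ
    funext z
    have hd : UpperHalfPlane.denom (γ : GL (Fin 2) ℝ) z = (γ 1 0 : ℂ) * z + γ 1 1 := by
      simp [UpperHalfPlane.denom]
    rw [ModularForm.SL_slash_apply, hd, homography_eq_smul, zpow_neg, zpow_ofNat]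
    exact chazyOp_eisChazy_smul γ z.im_pos
  { toFun := fun z => chazyOp eisChazy z
    slash_action_eq' := by
      rintro _ ⟨γ, rfl⟩
      exact slash γ
    holo' := by
      rw [UpperHalfPlane.mdifferentiable_iff]
      refine (differentiableOn_chazyOp isOpen_im_pos differentiableOn_eisChazy).congr fun z hz => ?_
      simp [ofComplex_apply_of_im_pos hz]
    zero_at_cusps' := fun hc => by
      rw [Subgroup.IsArithmetic.isCusp_iff_isCusp_SL2Z] at hc
      rw [OnePoint.isZeroAt_iff_forall_SL2Z hc]
      intro γ _
      refine (congrArg IsZeroAtImInfty (slash γ)).mpr ?_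
      have h := (analyticAt_eisQ_zero.div_const (c := 2)).eulerChazyOp.continuousAt.tendsto.comp
        (qParam_tendsto_atImInfty one_pos)
      -- Every term contains a factor of the form q d/dq, which vanishes at q = 0.
      have h0 : eulerChazyOp (fun q => eisQ q / 2) 0 = 0 := by simp [eulerChazyOp, eulerDeriv]
      rw [h0] at h
      have h' := h.const_mul ((2 * Real.pi * Complex.I) ^ 4)
      rw [mul_zero] at h'
      refine h'.congr fun z => ?_
      rw [chazyOp_eisChazy_eq z.im_pos]
      simp [Function.Periodic.qParam] }

theorem chazyOp_eisChazy {τ : ℂ} (hτ : 0 < τ.im) : chazyOp eisChazy τ = 0 := by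
  have h : chazyCuspForm = 0 :=
    rank_zero_iff_forall_zero.1 (CuspForm.rank_eq_zero_of_weight_lt_twelve (by norm_num)) _
  exact DFunLike.congr_fun h (⟨τ, hτ⟩ : UpperHalfPlane)

theorem isChazySolutionOn_eisChazy : IsChazySolutionOn eisChazy {τ | 0 < τ.im} :=
  isChazySolutionOn_iff.2 ⟨isOpen_im_pos, differentiableOn_eisChazy, fun _ => chazyOp_eisChazy⟩

/-- The Chazy equation for `E₂` as a function of `q`. -/
theorem eulerChazyOp_eisQ {q : ℂ} (hq : ‖q‖ < 1) : eulerChazyOp (fun q => eisQ q / 2) q = 0 := by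
  rcases eq_or_ne q 0 with rfl | h0
  · simp [eulerChazyOp, eulerDeriv]
  · have hc : (2 * Real.pi * Complex.I : ℂ) ≠ 0 := Complex.two_pi_I_ne_zero
    set τ := Complex.log q / (2 * Real.pi * Complex.I) with hτ
    have e : 2 * Real.pi * Complex.I * τ = Complex.log q := by rw [hτ, mul_div_cancel₀ _ hc]
    have him : 0 < τ.im := by
      have h := re_two_pi_I_mul τ
      rw [e, Complex.log_re] at h
      have := Real.log_neg (norm_pos_iff.2 h0) hq
      have h2 : 0 < 2 * Real.pi * τ.im := by linarith
      exact pos_of_mul_pos_right h2 Real.two_pi_pos.le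
    have := chazyOp_eisChazy_eq him
    rw [chazyOp_eisChazy him, e, Complex.exp_log h0] at this
    simpa [hc] using this.symm

/-! ### The real line as natural boundary of π i E₂. -/

theorem tendsto_eisChazy_I_mul_atTop :
    Tendsto (fun t : ℝ => eisChazy (Complex.I * t)) atTop (𝓝 (Real.pi * Complex.I)) := by
  have h₁ : Tendsto (fun t : ℝ => ((Real.exp (-(2 * Real.pi * t)) : ℝ) : ℂ)) atTop (𝓝 0) := by
    have : Tendsto (fun t : ℝ => Real.exp (-(2 * Real.pi * t))) atTop (𝓝 0) :=
      Real.tendsto_exp_neg_atTop_nhds_zero.comp (tendsto_id.const_mul_atTop Real.two_pi_pos)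
    exact_mod_cast (Complex.continuous_ofReal.tendsto 0).comp this
  have h₂ := (analyticAt_eisQ_zero.continuousAt.tendsto.comp h₁).const_mul (Real.pi * Complex.I)
  rw [eisQ_zero, mul_one] at h₂
  refine h₂.congr' ?_
  filter_upwards [eventually_gt_atTop 0] with t ht
  rw [eisChazy_eq (by simpa using ht)]
  simp only [Function.comp_apply]
  congr 2
  push_cast
  congr 1
  linear_combination (2 * Real.pi * t : ℂ) * Complex.I_sq.symm

/-- `π i E₂` has no analytic continuation to any real point. -/
theorem isSingularBoundaryPoint_eisChazy {p : ℂ} (hp : p.im = 0) :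
    IsSingularBoundaryPoint eisChazy {τ | 0 < τ.im} p := by
  rintro ⟨G, hG, hGe⟩
  have hb : ∀ᶠ x in 𝓝 p, ‖G x‖ < ‖G p‖ + 1 :=
    hG.continuousAt.norm.eventually_lt continuousAt_const (lt_add_one _)
  obtain ⟨ε, hε, hball⟩ := Metric.eventually_nhds_iff.1
    (hb.and (eventually_nhdsWithin_iff.1 hGe))
  have hbd : ∀ x : ℂ, dist x p < ε → 0 < x.im → ‖eisChazy x‖ ≤ ‖G p‖ + 1 := by
    intro x hx him
    obtain ⟨h₁, h₂⟩ := hball hx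
    rw [← h₂ him]
    exact h₁.le
  obtain ⟨r, hr⟩ := exists_rat_near p.re hε
  have hcop : IsCoprime r.num (r.den : ℤ) := Int.isCoprime_iff_gcd_eq_one.2 r.reduced
  obtain ⟨u, v, huv⟩ := hcop
  -- A Bézout relation completes the rational r near p to a matrix sending i∞ to r, so γ(it) tends
  -- to r inside the disk where the solution is bounded.
  let γ : Matrix.SpecialLinearGroup (Fin 2) ℤ :=
    ⟨!![r.num, -v; (r.den : ℤ), u], by rw [Matrix.det_fin_two_of]; linear_combination huv⟩
  have hn : (r.den : ℂ) ≠ 0 := by exact_mod_cast r.den_nz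
  have hdet : (r.num : ℂ) * u + v * r.den = 1 := by
    have : ((u * r.num + v * r.den : ℤ) : ℂ) = 1 := by rw [huv]; simp
    push_cast at this
    linear_combination this
  have hs : Tendsto (fun t : ℝ => ((r.den : ℂ) * (Complex.I * t) + u)⁻¹) atTop (𝓝 0) := by
    have ht : Tendsto (fun t : ℝ => ((t⁻¹ : ℝ) : ℂ)) atTop (𝓝 0) := by
      exact_mod_cast (Complex.continuous_ofReal.tendsto 0).comp tendsto_inv_atTop_zero
    have h₁ : Tendsto (fun t : ℝ => ((t⁻¹ : ℝ) : ℂ) *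
        ((r.den : ℂ) * Complex.I + u * ((t⁻¹ : ℝ) : ℂ))⁻¹) atTop
        (𝓝 (0 * ((r.den : ℂ) * Complex.I + u * 0)⁻¹)) :=
      ht.mul ((tendsto_const_nhds.add (ht.const_mul _)).inv₀
        (by simp))
    rw [zero_mul] at h₁
    refine h₁.congr' ?_
    filter_upwards [eventually_gt_atTop 0] with t ht
    have : (t : ℂ) ≠ 0 := by exact_mod_cast ht.ne'
    rw [Complex.ofReal_inv, ← mul_inv]
    congr 1
    field_simp
  have him : ∀ t : ℝ, 0 < t → 0 < (Complex.I * t).im := fun t ht => by simpa using ht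
  have hval : ∀ t : ℝ, 0 < t → ((r.num : ℂ) * (Complex.I * t) + (-v : ℤ)) /
      ((r.den : ℂ) * (Complex.I * t) + u) =
      (r.num : ℂ) / r.den - (r.den : ℂ)⁻¹ * ((r.den : ℂ) * (Complex.I * t) + u)⁻¹ := by
    intro t ht
    have h0 : (r.den : ℂ) * (Complex.I * t) + u ≠ 0 := by
      simpa [γ] using denom_ne_zero_of_im_pos γ (him t ht)
    rw [div_eq_iff h0, sub_mul, mul_assoc, inv_mul_cancel₀ h0]
    push_cast
    field_simp
    linear_combination -hdet
  have hlim : Tendsto (fun t : ℝ => ((r.num : ℂ) * (Complex.I * t) + (-v : ℤ)) /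
      ((r.den : ℂ) * (Complex.I * t) + u)) atTop (𝓝 ((r.num : ℂ) / r.den)) := by
    have := (hs.const_mul ((r.den : ℂ)⁻¹)).const_sub ((r.num : ℂ) / r.den)
    rw [mul_zero, sub_zero] at this
    refine this.congr' ?_
    filter_upwards [eventually_gt_atTop 0] with t ht
    exact (hval t ht).symm
  have hnear : dist ((r.num : ℂ) / r.den) p < ε := by
    have e : (r.num : ℂ) / r.den - p = (((r : ℝ) - p.re : ℝ) : ℂ) := by
      rw [← Complex.re_add_im p, hp]
      push_cast
      rw [Rat.cast_def]
      simp
    rw [dist_eq_norm, e, Complex.norm_real, Real.norm_eq_abs, abs_sub_comm]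
    exact hr
  have hbdd : ∀ᶠ t : ℝ in atTop, ‖eisChazy (((r.num : ℂ) * (Complex.I * t) + (-v : ℤ)) /
      ((r.den : ℂ) * (Complex.I * t) + u))‖ ≤ ‖G p‖ + 1 := by
    filter_upwards [hlim.eventually (isOpen_ball.mem_nhds hnear), eventually_gt_atTop 0]
      with t h₁ ht
    refine hbd _ h₁ ?_
    simpa [γ] using im_homography_pos γ (him t ht)
  -- With s = 1/(den·it + u) → 0, invariance reads y(it) = s² y(γ(it)) - 6 den·s. Boundedness of
  -- y(γ(it)) gives the limit 0, against π i.
  have hs₂ := hs.pow 2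
  rw [zero_pow two_ne_zero] at hs₂
  have h₁ := hs₂.zero_mul_isBoundedUnder_le (isBoundedUnder_of_eventually_le hbdd)
  have h₂ := h₁.sub (hs.const_mul (6 * (r.den : ℂ)))
  rw [mul_zero, sub_zero] at h₂
  have h₃ : Tendsto (fun t : ℝ => eisChazy (Complex.I * t)) atTop (𝓝 0) := by
    refine h₂.congr' ?_
    filter_upwards [eventually_gt_atTop 0] with t ht
    rw [← sl2Act_eisChazy γ (him t ht), sl2Act, det_intCast]
    simp [γ, div_eq_mul_inv, mul_comm]
  have := tendsto_nhds_unique h₃ tendsto_eisChazy_I_mul_atTop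
  simp at this

/-! ### Uniqueness of solutions analytic in q. -/

theorem eulerDeriv_pow_mul {h : ℂ → ℂ} (hh : AnalyticAt ℂ h 0) (n : ℕ) :
    eulerDeriv (fun q => q ^ n * h q) =ᶠ[𝓝 0] fun q => q ^ n * (n * h q + eulerDeriv h q) := by
  filter_upwards [hh.eventually_analyticAt] with q hq
  have := ((hasDerivAt_pow n q).mul hq.differentiableAt.hasDerivAt).deriv
  simp only [eulerDeriv]
  rw [show (fun q => q ^ n * h q) = (fun q => q ^ n) * h from rfl, this]
  cases n with
  | zero => simp
  | succ n => simp only [Nat.add_sub_cancel]; push_cast; ring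

theorem eulerDeriv_sub_eventuallyEq {F G : ℂ → ℂ} (hF : AnalyticAt ℂ F 0) (hG : AnalyticAt ℂ G 0) :
    eulerDeriv (fun q => F q - G q) =ᶠ[𝓝 0] fun q => eulerDeriv F q - eulerDeriv G q := by
  filter_upwards [hF.eventually_analyticAt, hG.eventually_analyticAt] with q h₁ h₂
  simp only [eulerDeriv]
  rw [deriv_fun_sub h₁.differentiableAt h₂.differentiableAt]
  ring

/-- A solution of the Chazy equation which is analytic in `q` near `q = 0`, with value `1/2`
there, is determined by its first derivative. -/
theorem eulerChazyOp_unique {F G : ℂ → ℂ} (hF : AnalyticAt ℂ F 0) (hG : AnalyticAt ℂ G 0)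
    (hF0 : F 0 = 1 / 2) (hG0 : G 0 = 1 / 2) (hd : deriv F 0 = deriv G 0)
    (hFc : ∀ᶠ q in 𝓝 0, eulerChazyOp F q = 0) (hGc : ∀ᶠ q in 𝓝 0, eulerChazyOp G q = 0) :
    F =ᶠ[𝓝 0] G := by
  have hR : AnalyticAt ℂ (fun q => F q - G q) 0 := hF.sub hG
  by_contra hne
  have hne' : ¬ ∀ᶠ q in 𝓝 (0 : ℂ), F q - G q = 0 := fun h => hne (h.mono fun q => sub_eq_zero.1)
  obtain ⟨n, g, hg, hg0, hRg⟩ := hR.exists_eventuallyEq_pow_smul_nonzero_iff.2 hne'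
  simp only [sub_zero, smul_eq_mul] at hRg
  have e₀ : (fun q => F q - G q) =ᶠ[𝓝 0] fun q => q ^ n * g q := hRg
  -- `S` is q d/dq conjugated by q^n; at q = 0 it is multiplication by n.
  set S : (ℂ → ℂ) → ℂ → ℂ := fun h q => n * h q + eulerDeriv h q with hS
  have hSa : ∀ h, AnalyticAt ℂ h 0 → AnalyticAt ℂ (S h) 0 :=
    fun h hh => (analyticAt_const.mul hh).add hh.eulerDeriv
  have hS0 : ∀ h, S h 0 = n * h 0 := fun h => by simp [hS, eulerDeriv]
  have g₁ := hSa g hg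
  have g₂ := hSa _ g₁
  have g₃ := hSa _ g₂
  have F₁ := hF.eulerDeriv
  have F₂ := F₁.eulerDeriv
  have G₁ := hG.eulerDeriv
  have G₂ := G₁.eulerDeriv
  have e₁ : (fun q => eulerDeriv F q - eulerDeriv G q) =ᶠ[𝓝 0] fun q => q ^ n * S g q :=
    (eulerDeriv_sub_eventuallyEq hF hG).symm.trans
      ((eulerDeriv_congr e₀).trans (eulerDeriv_pow_mul hg n))
  have e₂ : (fun q => eulerDeriv (eulerDeriv F) q - eulerDeriv (eulerDeriv G) q) =ᶠ[𝓝 0]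
      fun q => q ^ n * S (S g) q :=
    (eulerDeriv_sub_eventuallyEq F₁ G₁).symm.trans
      ((eulerDeriv_congr e₁).trans (eulerDeriv_pow_mul g₁ n))
  have e₃ : (fun q => eulerDeriv (eulerDeriv (eulerDeriv F)) q -
      eulerDeriv (eulerDeriv (eulerDeriv G)) q) =ᶠ[𝓝 0] fun q => q ^ n * S (S (S g)) q :=
    (eulerDeriv_sub_eventuallyEq F₂ G₂).symm.trans
      ((eulerDeriv_congr e₂).trans (eulerDeriv_pow_mul g₂ n))
  -- `B` is the difference of the two Chazy expressions divided by q^n. At 0 only the cubic term and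
  -- the term with F(0) = 1/2 survive, giving (n³ - n²) g(0).
  set B : ℂ → ℂ := fun q => S (S (S g)) q - 2 * (F q * S (S g) q +
    g q * eulerDeriv (eulerDeriv G) q) + 3 * S g q * (eulerDeriv F q + eulerDeriv G q) with hB
  have hBa : AnalyticAt ℂ B 0 :=
    (g₃.sub (analyticAt_const.mul ((hF.mul g₂).add (hg.mul G₂)))).add
      ((analyticAt_const.mul g₁).mul (F₁.add G₁))
  have hBz : ∀ᶠ q in 𝓝[≠] (0 : ℂ), B q = 0 := by
    filter_upwards [e₀.filter_mono nhdsWithin_le_nhds, e₁.filter_mono nhdsWithin_le_nhds,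
      e₂.filter_mono nhdsWithin_le_nhds, e₃.filter_mono nhdsWithin_le_nhds,
      hFc.filter_mono nhdsWithin_le_nhds, hGc.filter_mono nhdsWithin_le_nhds,
      self_mem_nhdsWithin] with q h₀ h₁ h₂ h₃ hf hg' hq
    have : q ^ n * B q = 0 := by
      simp only [eulerChazyOp] at hf hg'
      simp only [hB]
      linear_combination hf - hg' - h₃ + 2 * F q * h₂ + 2 * eulerDeriv (eulerDeriv G) q * h₀ -
        3 * (eulerDeriv F q + eulerDeriv G q) * h₁
    exact (mul_eq_zero.1 this).resolve_left (pow_ne_zero n hq)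
  have hB0 : B 0 = 0 := by
    have h₁ : Tendsto B (𝓝[≠] 0) (𝓝 (B 0)) := hBa.continuousAt.tendsto.mono_left nhdsWithin_le_nhds
    have h₂ : Tendsto B (𝓝[≠] 0) (𝓝 0) :=
      tendsto_const_nhds.congr' (hBz.mono fun q hq => hq.symm)
    exact tendsto_nhds_unique h₁ h₂
  have hB0' : ((n : ℂ) ^ 2 * (n - 1)) * g 0 = 0 := by
    have z : ∀ f : ℂ → ℂ, eulerDeriv f 0 = 0 := fun f => by simp [eulerDeriv]
    simp only [hB, hS0, z, hF0] at hB0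
    linear_combination hB0
  have hn := (mul_eq_zero.1 hB0').resolve_right hg0
  -- The exponent 0 contradicts the equal values at 0, the exponent 1 the equal first derivatives.
  rcases mul_eq_zero.1 hn with h | h
  · have hn0 : n = 0 := by exact_mod_cast pow_eq_zero_iff (two_ne_zero) |>.1 h
    have := hRg.self_of_nhds
    rw [hn0, hF0, hG0, sub_self, pow_zero, one_mul] at this
    exact hg0 this.symm
  · have hn1 : n = 1 := by exact_mod_cast sub_eq_zero.1 h
    have h₁ := e₀.deriv_eq
    rw [deriv_fun_sub hF.differentiableAt hG.differentiableAt, hd, sub_self, hn1] at h₁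
    have h₂ := ((hasDerivAt_pow 1 (0 : ℂ)).mul hg.differentiableAt.hasDerivAt).deriv
    rw [show (fun q : ℂ => q ^ 1 * g q) = (fun q => q ^ 1) * g from rfl, h₂] at h₁
    simp at h₁
    exact hg0 h₁.symm

/-! ### Existence and uniqueness of w. -/

/-- The function `1 + q w(q)`. -/
noncomputable def oneAddMul (w : ℂ → ℂ) (q : ℂ) : ℂ := 1 + q * w q

/-- The function `u'/(2u)`, `u(x) = e^x (1 + e^x w(e^x))`, in the variable `q = e^x`. -/
noncomputable def halfLogDerivQ (w : ℂ → ℂ) (q : ℂ) : ℂ :=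
  1 / 2 * (1 + q * (deriv (oneAddMul w) q / oneAddMul w q))

theorem AnalyticAt.oneAddMul {w : ℂ → ℂ} {q : ℂ} (hw : AnalyticAt ℂ w q) :
    AnalyticAt ℂ (oneAddMul w) q :=
  analyticAt_const.add (analyticAt_id.mul hw)

theorem oneAddMul_zero (w : ℂ → ℂ) : oneAddMul w 0 = 1 := by simp [oneAddMul]

theorem deriv_oneAddMul_zero {w : ℂ → ℂ} (hw : AnalyticAt ℂ w 0) : deriv (oneAddMul w) 0 = w 0 := by
  have h := ((hasDerivAt_id (0 : ℂ)).mul hw.differentiableAt.hasDerivAt).const_add 1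
  have := h.deriv
  simp only [id, one_mul, zero_mul, add_zero] at this
  exact this

theorem analyticAt_logDeriv_oneAddMul {w : ℂ → ℂ} (hw : AnalyticAt ℂ w 0) :
    AnalyticAt ℂ (fun q => deriv (oneAddMul w) q / oneAddMul w q) 0 :=
  hw.oneAddMul.deriv.div hw.oneAddMul (by simp [oneAddMul_zero])

theorem analyticAt_halfLogDerivQ {w : ℂ → ℂ} (hw : AnalyticAt ℂ w 0) :
    AnalyticAt ℂ (halfLogDerivQ w) 0 :=
  analyticAt_const.mul (analyticAt_const.add
    (analyticAt_id.mul (analyticAt_logDeriv_oneAddMul hw)))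

theorem halfLogDerivQ_zero (w : ℂ → ℂ) : halfLogDerivQ w 0 = 1 / 2 := by simp [halfLogDerivQ]

theorem deriv_halfLogDerivQ_zero {w : ℂ → ℂ} (hw : AnalyticAt ℂ w 0) :
    deriv (halfLogDerivQ w) 0 = w 0 / 2 := by
  have h := ((((hasDerivAt_id (0 : ℂ)).mul
    (analyticAt_logDeriv_oneAddMul hw).differentiableAt.hasDerivAt).const_add 1).const_mul
      (1 / 2 : ℂ)).deriv
  simp only [id, one_mul, zero_mul, add_zero, oneAddMul_zero, deriv_oneAddMul_zero hw, div_one] at h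
  refine Eq.trans h ?_
  ring

theorem halfLogDeriv_expU {w : ℂ → ℂ} {x : ℂ} (hw : DifferentiableAt ℂ (oneAddMul w) (Complex.exp x))
    (h0 : oneAddMul w (Complex.exp x) ≠ 0) :
    halfLogDeriv (expU w) x = halfLogDerivQ w (Complex.exp x) := by
  have e : expU w = fun x => Complex.exp x * oneAddMul w (Complex.exp x) := rfl
  have hd := ((Complex.hasDerivAt_exp x).mul
    (hw.hasDerivAt.comp x (Complex.hasDerivAt_exp x))).deriv
  have hd' : deriv (expU w) x = Complex.exp x * oneAddMul w (Complex.exp x) +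
      Complex.exp x * (deriv (oneAddMul w) (Complex.exp x) * Complex.exp x) := hd
  rw [halfLogDeriv, hd', e, halfLogDerivQ]
  have := Complex.exp_ne_zero x
  field_simp

theorem eventually_halfLogDeriv_expU {w : ℂ → ℂ} (hw : AnalyticAt ℂ w 0) :
    ∀ᶠ q in 𝓝 (0 : ℂ), ∀ x, Complex.exp x = q →
      halfLogDeriv (expU w) x = halfLogDerivQ w (Complex.exp x) := by
  filter_upwards [hw.oneAddMul.eventually_analyticAt,
    hw.oneAddMul.continuousAt.eventually_ne (by rw [oneAddMul_zero]; exact one_ne_zero)]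
    with q h₁ h₂ x hx
  exact halfLogDeriv_expU (by rw [hx]; exact h₁.differentiableAt) (by rwa [hx])

/-- A property of `e^x` which holds near `0` holds for all `x` with `Re x` sufficiently
negative. -/
theorem exists_forall_re_lt_of_eventually {p : ℂ → Prop} (h : ∀ᶠ q in 𝓝 (0 : ℂ), p q) :
    ∃ ρ : ℝ, ∀ x : ℂ, x.re < -ρ → p (Complex.exp x) := by
  obtain ⟨ε, hε, hb⟩ := Metric.eventually_nhds_iff.1 h
  refine ⟨-Real.log ε, fun x hx => hb ?_⟩
  rw [neg_neg, Real.lt_log_iff_exp_lt hε] at hx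
  rwa [dist_zero_right, Complex.norm_exp]

theorem eventually_of_forall_re_lt {p : ℂ → Prop} {ρ : ℝ}
    (h : ∀ x : ℂ, x.re < -ρ → p (Complex.exp x)) : ∀ᶠ q in 𝓝[≠] (0 : ℂ), p q := by
  rw [eventually_nhdsWithin_iff, Metric.eventually_nhds_iff]
  refine ⟨Real.exp (-ρ), Real.exp_pos _, fun q hq h0 => ?_⟩
  have h0' : q ≠ 0 := h0
  rw [← Complex.exp_log h0']
  apply h
  rwa [Complex.log_re, Real.log_lt_iff_lt_exp (norm_pos_iff.2 h0'), ← dist_zero_right]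

theorem IsExpSolution.eventually_eulerChazyOp {a : ℂ} {w : ℂ → ℂ} (h : IsExpSolution a w) :
    ∀ᶠ q in 𝓝 0, eulerChazyOp (halfLogDerivQ w) q = 0 := by
  obtain ⟨hw, -, ρ, hsol⟩ := h
  obtain ⟨-, -, hsol⟩ := isChazySolutionOn_iff.1 hsol
  have hev := (eventually_halfLogDeriv_expU hw).eventually_nhds.and
    (analyticAt_halfLogDerivQ hw).eventually_analyticAt
  obtain ⟨ε, hε, hb⟩ := Metric.eventually_nhds_iff_ball.1 hev
  have hd : DifferentiableOn ℂ (halfLogDerivQ w) (ball 0 ε) :=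
    fun q hq => (hb q hq).2.differentiableAt.differentiableWithinAt
  have h₁ : ∀ᶠ q in 𝓝[≠] (0 : ℂ), q ∈ ball (0 : ℂ) ε → eulerChazyOp (halfLogDerivQ w) q = 0 := by
    refine eventually_of_forall_re_lt (ρ := ρ) fun x hx hxb => ?_
    rw [← chazyOp_comp_exp isOpen_ball hd hxb, ← hsol x hx]
    refine chazyOp_congr ?_
    filter_upwards [Complex.continuous_exp.continuousAt.eventually (hb _ hxb).1] with z hz
    exact (hz z rfl).symm
  rw [eventually_nhdsWithin_iff] at h₁
  filter_upwards [h₁, ball_mem_nhds 0 hε] with q hq hqb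
  rcases eq_or_ne q 0 with rfl | h0
  · simp [eulerChazyOp, eulerDeriv]
  · exact hq h0 hqb

theorem analyticAt_eisQ_comp_const_mul (b : ℂ) : AnalyticAt ℂ (fun q => eisQ (b * q) / 2) 0 := by
  refine AnalyticAt.div_const (AnalyticAt.fun_comp (g := eisQ) ?_ (by fun_prop))
  rw [mul_zero]
  exact analyticAt_eisQ_zero

theorem deriv_eisQ_comp_const_mul (b : ℂ) : deriv (fun q => eisQ (b * q) / 2) 0 = -12 * b := by
  rw [deriv_div_const, deriv_comp_mul_left, mul_zero, deriv_eisQ_zero, smul_eq_mul]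
  ring

theorem eventually_norm_const_mul_lt_one (b : ℂ) : ∀ᶠ q in 𝓝 (0 : ℂ), ‖b * q‖ < 1 := by
  have : ContinuousAt (fun q : ℂ => ‖b * q‖) 0 := by fun_prop
  exact this.eventually_lt continuousAt_const (by simp)

theorem eventually_eulerChazyOp_eisQ (b : ℂ) :
    ∀ᶠ q in 𝓝 (0 : ℂ), eulerChazyOp (fun q => eisQ (b * q) / 2) q = 0 := by
  filter_upwards [eventually_norm_const_mul_lt_one b] with q hq
  rw [eulerChazyOp_comp_const_mul (fun q => eisQ q / 2), eulerChazyOp_eisQ hq]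

theorem IsExpSolution.halfLogDerivQ_eventuallyEq {a : ℂ} {w : ℂ → ℂ} (h : IsExpSolution a w) :
    halfLogDerivQ w =ᶠ[𝓝 0] fun q => eisQ (-a / 24 * q) / 2 := by
  refine eulerChazyOp_unique (analyticAt_halfLogDerivQ h.1) (analyticAt_eisQ_comp_const_mul _)
    (halfLogDerivQ_zero w) (by simp [eisQ_zero]) ?_ h.eventually_eulerChazyOp
    (eventually_eulerChazyOp_eisQ _)
  rw [deriv_halfLogDerivQ_zero h.1, deriv_eisQ_comp_const_mul, h.2.1]
  ring

/-- Both solutions are `eisQ (-a / 24 * q) / 2` near 0, so the functions 1 + q w₁ and 1 + q w₂ have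
the same logarithmic derivative and the same value 1 at 0. -/
theorem IsExpSolution.eventuallyEq {a : ℂ} {w₁ w₂ : ℂ → ℂ} (h₁ : IsExpSolution a w₁)
    (h₂ : IsExpSolution a w₂) : w₁ =ᶠ[𝓝 0] w₂ := by
  have hQ := h₁.halfLogDerivQ_eventuallyEq.trans h₂.halfLogDerivQ_eventuallyEq.symm
  have v₁ := h₁.1.oneAddMul
  have v₂ := h₂.1.oneAddMul
  have n₁ : oneAddMul w₁ 0 ≠ 0 := by simp [oneAddMul_zero]
  have n₂ : oneAddMul w₂ 0 ≠ 0 := by simp [oneAddMul_zero]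
  set f : ℂ → ℂ := fun q => oneAddMul w₁ q / oneAddMul w₂ q with hf
  have hfa : AnalyticAt ℂ f 0 := v₁.div v₂ n₂
  have hd : ∀ᶠ q in 𝓝[≠] (0 : ℂ), deriv f q = 0 := by
    filter_upwards [hQ.filter_mono nhdsWithin_le_nhds,
      v₁.eventually_analyticAt.filter_mono nhdsWithin_le_nhds,
      v₂.eventually_analyticAt.filter_mono nhdsWithin_le_nhds,
      (v₁.continuousAt.eventually_ne n₁).filter_mono nhdsWithin_le_nhds,
      (v₂.continuousAt.eventually_ne n₂).filter_mono nhdsWithin_le_nhds,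
      self_mem_nhdsWithin] with q hq a₁ a₂ m₁ m₂ h0
    have h0' : q ≠ 0 := h0
    simp only [halfLogDerivQ] at hq
    have h3 : deriv (oneAddMul w₁) q / oneAddMul w₁ q = deriv (oneAddMul w₂) q / oneAddMul w₂ q :=
      mul_left_cancel₀ h0' (by linear_combination 2 * hq)
    rw [div_eq_div_iff m₁ m₂] at h3
    rw [hf, deriv_fun_div a₁.differentiableAt a₂.differentiableAt m₂, h3]
    ring
  have hd' : ∀ᶠ q in 𝓝 (0 : ℂ), deriv f q = 0 :=
    hfa.deriv.frequently_zero_iff_eventually_zero.1 hd.frequently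
  obtain ⟨ε, hε, hb⟩ := Metric.eventually_nhds_iff_ball.1 (hd'.and hfa.eventually_analyticAt)
  filter_upwards [ball_mem_nhds (0 : ℂ) hε, v₂.continuousAt.eventually_ne n₂] with q hq m₂
  have hc : f q = f 0 := isOpen_ball.is_const_of_deriv_eq_zero
    (convex_ball (0 : ℂ) ε).isPreconnected
    (fun z hz => (hb z hz).2.differentiableAt.differentiableWithinAt) (fun z hz => (hb z hz).1)
    hq (mem_ball_self hε)
  simp only [hf, oneAddMul_zero, div_one] at hc
  rw [div_eq_one_iff_eq m₂] at hc
  rcases eq_or_ne q 0 with rfl | h0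
  · rw [h₁.2.1, h₂.2.1]
  · exact mul_left_cancel₀ h0 (add_left_cancel hc)

/-- The first-order linear equation `u' / (2u) = Q(e^x)` for `u = e^x (1 + e^x w(e^x))`. -/
theorem exists_halfLogDerivQ_eq {Q : ℂ → ℂ} (hQ : AnalyticAt ℂ Q 0) (h0 : Q 0 = 1 / 2) :
    ∃ w : ℂ → ℂ, AnalyticAt ℂ w 0 ∧ w 0 = 2 * deriv Q 0 ∧ halfLogDerivQ w =ᶠ[𝓝 0] Q := by
  obtain ⟨ε, hε, hb⟩ := hQ.exists_ball_analyticOnNhd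
  have hm : DifferentiableOn ℂ (dslope Q 0) (ball 0 ε) :=
    (Complex.differentiableOn_dslope (ball_mem_nhds 0 hε)).2
      fun q hq => (hb q hq).differentiableAt.differentiableWithinAt
  -- For v = 1 + q w the equation is v'/v = (2Q - 1)/q, which is twice the slope of Q at 0. Hence v
  -- = exp M with M(0) = 0, and w is the slope of v at 0.
  obtain ⟨M, hM0, hM⟩ := (hm.const_mul 2).isExactOn_ball.with_val_at 0 0
  have hv : ∀ q ∈ ball (0 : ℂ) ε, HasDerivAt (fun q => Complex.exp (M q))
      (Complex.exp (M q) * (2 * dslope Q 0 q)) q := fun q hq => (hM q hq).cexp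
  have hw : DifferentiableOn ℂ (dslope (fun q => Complex.exp (M q)) 0) (ball 0 ε) :=
    (Complex.differentiableOn_dslope (ball_mem_nhds 0 hε)).2
      fun q hq => (hv q hq).differentiableAt.differentiableWithinAt
  have he : oneAddMul (dslope (fun q => Complex.exp (M q)) 0) = fun q => Complex.exp (M q) := by
    funext q
    have := sub_smul_dslope (fun q => Complex.exp (M q)) 0 q
    simp only [sub_zero, smul_eq_mul, hM0, Complex.exp_zero] at this
    rw [oneAddMul, this]
    ring
  refine ⟨_, hw.analyticAt (ball_mem_nhds 0 hε), ?_, ?_⟩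
  · rw [dslope_same, (hv 0 (mem_ball_self hε)).deriv, hM0, dslope_same]
    simp
  · filter_upwards [ball_mem_nhds (0 : ℂ) hε] with q hq
    rw [halfLogDerivQ, he, (hv q hq).deriv, mul_div_cancel_left₀ _ (Complex.exp_ne_zero _)]
    have := sub_smul_dslope Q 0 q
    simp only [sub_zero, smul_eq_mul, h0] at this
    linear_combination this

theorem exists_isExpSolution (a : ℂ) : ∃ w : ℂ → ℂ, IsExpSolution a w := by
  -- The derivative of `eisQ (b * q) / 2` at 0 is -12b, and w(0) is twice that, so b = -a/24 gives
  -- w(0) = a.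
  obtain ⟨w, hw, hw0, hwQ⟩ := exists_halfLogDerivQ_eq (analyticAt_eisQ_comp_const_mul (-a / 24))
    (by simp [eisQ_zero])
  refine ⟨w, hw, ?_, ?_⟩
  · rw [hw0, deriv_eisQ_comp_const_mul]
    ring
  · obtain ⟨ρ, hρ⟩ := exists_forall_re_lt_of_eventually
      (((eventually_halfLogDeriv_expU hw).and (hwQ.and
        ((analyticAt_eisQ_comp_const_mul (-a / 24)).eventually_analyticAt.and
        (eventually_eulerChazyOp_eisQ (-a / 24))))).eventually_nhds)
    have hop : IsOpen {x : ℂ | x.re < -ρ} := isOpen_lt Complex.continuous_re continuous_const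
    have e : ∀ x : ℂ, x.re < -ρ → halfLogDeriv (expU w) =ᶠ[𝓝 x]
        fun x => eisQ (-a / 24 * Complex.exp x) / 2 := by
      intro x hx
      filter_upwards [Complex.continuous_exp.continuousAt.eventually (hρ x hx)] with z hz
      rw [hz.1 z rfl, hz.2.1]
    have hd : ∀ x : ℂ, x.re < -ρ →
        AnalyticAt ℂ (fun q => eisQ (-a / 24 * q) / 2) (Complex.exp x) :=
      fun x hx => (hρ x hx).self_of_nhds.2.2.1
    refine ⟨ρ, isChazySolutionOn_iff.2 ⟨hop, fun x hx => ?_, fun x hx => ?_⟩⟩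
    · refine DifferentiableAt.differentiableWithinAt ?_
      exact ((hd x hx).differentiableAt.comp x Complex.differentiableAt_exp).congr_of_eventuallyEq
        (e x hx)
    · obtain ⟨ε, hε, hb⟩ := Metric.eventually_nhds_iff_ball.1 (hd x hx).eventually_analyticAt
      rw [chazyOp_congr (e x hx), chazyOp_comp_exp (F := fun q => eisQ (-a / 24 * q) / 2)
        isOpen_ball
        (fun q hq => (hb q hq).differentiableAt.differentiableWithinAt) (mem_ball_self hε)]
      exact (hρ x hx).self_of_nhds.2.2.2

/-! ### The solution on its half-plane. -/

/-- The solution `x ↦ E₂(b e^x) / 2` of the Chazy equation, as a transform of `π i E₂`. -/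
noncomputable def eisExp (b : ℂ) : ℂ → ℂ :=
  sl2Act 1 (Complex.log b) 0 (2 * Real.pi * Complex.I) eisChazy

theorem im_div_two_pi_I (z : ℂ) : (z / (2 * Real.pi * Complex.I)).im = -z.re / (2 * Real.pi) := by
  have h := re_two_pi_I_mul (z / (2 * Real.pi * Complex.I))
  rw [mul_div_cancel₀ _ Complex.two_pi_I_ne_zero] at h
  rw [h, neg_neg, mul_div_cancel_left₀ _ Real.two_pi_pos.ne']

/-- Im((x + log b)/(2π i)) = -(Re x + log |b|)/(2π). The case b = 0 is covered by the default value
0 of both logarithms. -/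
theorem eisExp_domain (b : ℂ) : {x : ℂ | 0 * x + 2 * Real.pi * Complex.I ≠ 0 ∧
    (1 * x + Complex.log b) / (0 * x + 2 * Real.pi * Complex.I) ∈ {τ : ℂ | 0 < τ.im}} =
    {x : ℂ | x.re < -Real.log ‖b‖} := by
  ext x
  have h0 : (2 * Real.pi * Complex.I : ℂ) ≠ 0 := Complex.two_pi_I_ne_zero
  simp only [zero_mul, zero_add, one_mul, mem_ofPred_eq, im_div_two_pi_I, h0, ne_eq,
    not_false_eq_true, true_and, Complex.add_re, Complex.log_re, div_pos_iff_of_pos_right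
    Real.two_pi_pos]
  constructor <;> intro h <;> linarith

theorem isChazySolutionOn_eisExp (b : ℂ) :
    IsChazySolutionOn (eisExp b) {x | x.re < -Real.log ‖b‖} := by
  rw [← eisExp_domain]
  exact isChazySolutionOn_eisChazy.sl2Act _ _ _ _

theorem isSingularBoundaryPoint_eisExp (b : ℂ) {p : ℂ} (hp : p.re = -Real.log ‖b‖) :
    IsSingularBoundaryPoint (eisExp b) {x | x.re < -Real.log ‖b‖} p := by
  have h0 : (2 * Real.pi * Complex.I : ℂ) ≠ 0 := Complex.two_pi_I_ne_zero
  rw [← eisExp_domain]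
  refine IsSingularBoundaryPoint.sl2Act (by simp) (by simp)
    (isSingularBoundaryPoint_eisChazy ?_)
  rw [zero_mul, zero_add, one_mul, im_div_two_pi_I, Complex.add_re, Complex.log_re, hp]
  simp

theorem norm_mul_exp_lt_one {b : ℂ} (hb : b ≠ 0) {x : ℂ} (hx : x.re < -Real.log ‖b‖) :
    ‖b * Complex.exp x‖ < 1 := by
  have hb' : 0 < ‖b‖ := norm_pos_iff.2 hb
  rw [norm_mul, Complex.norm_exp]
  calc ‖b‖ * Real.exp x.re < ‖b‖ * Real.exp (-Real.log ‖b‖) := by gcongr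
    _ = 1 := by rw [Real.exp_neg, Real.exp_log hb', mul_inv_cancel₀ hb'.ne']

theorem eisExp_eq {b : ℂ} (hb : b ≠ 0) {x : ℂ} (hx : x.re < -Real.log ‖b‖) :
    eisExp b x = eisQ (b * Complex.exp x) / 2 := by
  have h0 : (2 * Real.pi * Complex.I : ℂ) ≠ 0 := Complex.two_pi_I_ne_zero
  have hpi : (Real.pi : ℂ) ≠ 0 := by exact_mod_cast Real.pi_ne_zero
  have hm : x ∈ {x : ℂ | x.re < -Real.log ‖b‖} := hx
  rw [← eisExp_domain] at hm
  have him := hm.2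
  rw [eisExp, sl2Act, eisChazy_eq him, zero_mul, zero_add, mul_div_cancel₀ _ h0, one_mul,
    Complex.exp_add, Complex.exp_log hb, mul_comm b]
  have hI := Complex.I_ne_zero
  field_simp
  ring

/-! ### The perturbed family and its limit as ε → 0. -/

theorem homography_eq (x₀ x : ℂ) (ε : ℝ) (hx : x - Complex.I * ε ≠ 0) :
    ((x₀ + ε) * x + -(Complex.I * ε * x₀)) / (1 * x + -(Complex.I * ε)) =
      x₀ + ε * x / (x - Complex.I * ε) := by
  rw [one_mul, ← sub_eq_add_neg, eq_comm, add_div' _ _ _ hx]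
  congr 1
  ring

/-- This form turns exp of the homography into e^(x₀ + ε) times exp(-2A/X), the variable of the
boundary expansion. -/
theorem homography_eq' (x₀ x : ℂ) (ε : ℝ) (hx : x - Complex.I * ε ≠ 0) :
    x₀ + ε * x / (x - Complex.I * ε) =
      x₀ + ε + -(2 * expansionParam ε / (x - Complex.I * ε)) := by
  rw [add_assoc]
  congr 1
  rw [div_eq_iff hx, add_mul, neg_mul, div_mul_cancel₀ _ hx, expansionParam]
  ring

theorem perturbedFamily_eq (x₀ x : ℂ) (Y : ℂ → ℂ) (ε : ℝ) (hx : x - Complex.I * ε ≠ 0) :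
    perturbedFamily x₀ Y ε x = -6 / (x - Complex.I * ε) +
      expansionParam ε / (x - Complex.I * ε) ^ 2 *
        (2 * Y (x₀ + ε * x / (x - Complex.I * ε))) := by
  rw [perturbedFamily, sl2Act, homography_eq x₀ x ε hx, one_mul, ← sub_eq_add_neg, expansionParam]
  field_simp
  ring

theorem perturbedFamily_zero (x₀ x : ℂ) (Y : ℂ → ℂ) : perturbedFamily x₀ Y 0 x = -6 / x := by
  simp [perturbedFamily, sl2Act, neg_div]

theorem tendstoUniformlyOn_perturbedFamily {x₀ : ℂ} {Y : ℂ → ℂ} (hY : ContinuousAt Y x₀)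
    {δ : ℝ} (hδ : 0 < δ) :
    TendstoUniformlyOn (perturbedFamily x₀ Y) (fun x : ℂ => -6 / x) (𝓝[≠] (0 : ℝ))
      {x : ℂ | δ ≤ ‖x‖} := by
  rw [Metric.tendstoUniformlyOn_iff]
  intro e he
  set K := ‖Y x₀‖ + 1 with hK
  have hKpos : 0 < K := by positivity
  have hb : ∀ᶠ z in 𝓝 x₀, ‖Y z‖ < K :=
    hY.norm.eventually_lt continuousAt_const (lt_add_one _)
  obtain ⟨η, hη, hball⟩ := Metric.eventually_nhds_iff.1 hb
  have c₁ : ∀ᶠ ε : ℝ in 𝓝 0, |ε| < δ / 2 :=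
    continuous_abs.continuousAt.eventually_lt continuousAt_const (by simpa using hδ)
  have c₂ : ∀ᶠ ε : ℝ in 𝓝 0, 2 * |ε| < η :=
    ContinuousAt.eventually_lt (by fun_prop) continuousAt_const (by simpa using hη)
  have c₃ : ∀ᶠ ε : ℝ in 𝓝 0, 6 * |ε| / (δ * (δ / 2)) + |ε| ^ 2 / (δ / 2) ^ 2 * K < e :=
    ContinuousAt.eventually_lt (by fun_prop) continuousAt_const (by simpa using he)
  refine Filter.Eventually.filter_mono nhdsWithin_le_nhds ?_
  filter_upwards [c₁, c₂, c₃] with ε h₁ h₂ h₃ x hx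
  have hx' : δ ≤ ‖x‖ := hx
  have hx0 : x ≠ 0 := norm_pos_iff.1 (hδ.trans_le hx')
  have hIε : ‖Complex.I * (ε : ℂ)‖ = |ε| := by simp
  -- From |ε| < δ/2 ≤ |x|/2. It puts the image of x within 2|ε| of x₀, where Y is bounded by `K`.
  have hX : ‖x‖ / 2 ≤ ‖x - Complex.I * ε‖ := by
    have := norm_sub_norm_le x (Complex.I * ε)
    rw [hIε] at this
    linarith
  have hXδ : δ / 2 ≤ ‖x - Complex.I * ε‖ := by linarith
  have hXpos : 0 < ‖x - Complex.I * ε‖ := by linarith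
  have hX0 : x - Complex.I * ε ≠ 0 := norm_pos_iff.1 hXpos
  have hYb : ‖Y (x₀ + ε * x / (x - Complex.I * ε))‖ ≤ K := by
    refine (hball ?_).le
    rw [dist_self_add_left, norm_div, norm_mul, Complex.norm_real, Real.norm_eq_abs,
      div_lt_iff₀ hXpos]
    calc |ε| * ‖x‖ ≤ |ε| * (2 * ‖x - Complex.I * ε‖) := by gcongr; linarith
      _ = 2 * |ε| * ‖x - Complex.I * ε‖ := by ring
      _ < η * ‖x - Complex.I * ε‖ := by gcongr
  have heq : -6 / x - perturbedFamily x₀ Y ε x = 6 * (Complex.I * ε) / (x * (x - Complex.I * ε)) -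
      2 * expansionParam ε / (x - Complex.I * ε) ^ 2 * Y (x₀ + ε * x / (x - Complex.I * ε)) := by
    rw [perturbedFamily_eq x₀ x Y ε hX0]
    generalize Y (x₀ + ε * x / (x - Complex.I * ε)) = y
    have : -6 / x + 6 / (x - Complex.I * ε) =
        6 * (Complex.I * ε) / (x * (x - Complex.I * ε)) := by
      field_simp
      ring
    rw [← this]
    ring
  have hA : ‖2 * expansionParam ε‖ = |ε| ^ 2 := by
    rw [expansionParam, show (2 : ℂ) * -(Complex.I * (ε : ℂ) ^ 2 / 2) =
      -(Complex.I * (ε : ℂ) ^ 2) by ring]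
    simp
  rw [dist_eq_norm, heq]
  refine lt_of_le_of_lt ((norm_sub_le _ _).trans (add_le_add ?_ ?_)) h₃
  · rw [norm_div, norm_mul 6, norm_mul x, hIε, Complex.norm_ofNat]
    gcongr
  · rw [norm_mul, norm_div, hA, norm_pow]
    gcongr

theorem tendsto_mul_perturbedFamily {x₀ : ℂ} {Y : ℂ → ℂ} (hY : ContinuousAt Y x₀) {x : ℂ}
    (hx : x ≠ 0) :
    Tendsto (fun ε : ℝ => x * perturbedFamily x₀ Y ε x) (𝓝[≠] 0) (𝓝 (-6)) := by
  have h := ((tendstoUniformlyOn_perturbedFamily hY (norm_pos_iff.2 hx)).tendsto_at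
    (le_refl ‖x‖ : x ∈ {z : ℂ | ‖x‖ ≤ ‖z‖})).const_mul x
  rwa [mul_div_cancel₀ _ hx] at h

/-! ### The boundary circle. -/

/-- The centre of the circle on which `Re (x₀ + ε x / (x - i ε)) = Re x₀ + ε + M`. -/
noncomputable def circleCentre (M ε : ℝ) : ℂ := Complex.I * ε + Complex.I * (ε ^ 2 / (2 * M) : ℝ)

/-- The radius of the circle on which `Re (x₀ + ε x / (x - i ε)) = Re x₀ + ε + M`. -/
noncomputable def circleRadius (M ε : ℝ) : ℝ := ε ^ 2 / (2 * M)

theorem re_homography (x₀ x : ℂ) (ε : ℝ) (hx : x - Complex.I * ε ≠ 0) :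
    (x₀ + ε * x / (x - Complex.I * ε)).re =
      x₀.re + ε + ε ^ 2 * (x - Complex.I * ε).im / ‖x - Complex.I * ε‖ ^ 2 := by
  rw [homography_eq' x₀ x ε hx, expansionParam, Complex.add_re, Complex.add_re, Complex.ofReal_re]
  congr 1
  rw [show -(2 * -(Complex.I * (ε : ℂ) ^ 2 / 2) / (x - Complex.I * ε)) =
    ((ε ^ 2 : ℝ) : ℂ) * (Complex.I * (x - Complex.I * ε)⁻¹) by push_cast; ring,
    Complex.re_ofReal_mul, Complex.I_mul_re, Complex.inv_im, Complex.normSq_eq_norm_sq]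
  ring

theorem dist_circleCentre_sq (x : ℂ) {M : ℝ} (hM : M ≠ 0) (ε : ℝ) :
    M * (dist x (circleCentre M ε) ^ 2 - circleRadius M ε ^ 2) =
      M * ‖x - Complex.I * ε‖ ^ 2 - ε ^ 2 * (x - Complex.I * ε).im := by
  rw [dist_eq_norm, ← Complex.normSq_eq_norm_sq, ← Complex.normSq_eq_norm_sq, Complex.normSq_apply,
    Complex.normSq_apply]
  have hr : 2 * M * circleRadius M ε = ε ^ 2 := mul_div_cancel₀ _ (by positivity)
  rw [← hr, show circleCentre M ε = Complex.I * ε + Complex.I * (circleRadius M ε : ℝ) from rfl]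
  simp
  ring

theorem dist_circleCentre_sq_eq (x₀ x : ℂ) {M : ℝ} (hM : M ≠ 0) (ε : ℝ)
    (hx : x - Complex.I * ε ≠ 0) :
    M * (dist x (circleCentre M ε) ^ 2 - circleRadius M ε ^ 2) =
      ‖x - Complex.I * ε‖ ^ 2 * (x₀.re + ε + M - (x₀ + ε * x / (x - Complex.I * ε)).re) := by
  rw [dist_circleCentre_sq x hM, re_homography x₀ x ε hx]
  have : ‖x - Complex.I * ε‖ ≠ 0 := norm_ne_zero_iff.2 hx
  field_simp
  ring

theorem circleRadius_pos {M ε : ℝ} (hM : 0 < M) (hε : ε ≠ 0) : 0 < circleRadius M ε := by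
  rw [circleRadius]
  positivity

theorem I_mul_mem_sphere {M : ℝ} (hM : 0 < M) (ε : ℝ) :
    Complex.I * ε ∈ sphere (circleCentre M ε) (circleRadius M ε) := by
  rw [mem_sphere, dist_eq_norm, circleCentre, sub_add_cancel_left, norm_neg, norm_mul,
    Complex.norm_I, one_mul, Complex.norm_real, Real.norm_eq_abs, circleRadius, abs_of_nonneg]
  positivity

/-- By `dist_circleCentre_sq_eq`, being outside the circle and being mapped into the half-plane are
governed by the same sign. The pole iε lies on the circle, hence in neither set. -/
theorem compl_closedBall_eq (x₀ : ℂ) {M ε : ℝ} (hM : 0 < M) (hε : ε ≠ 0) :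
    (closedBall (circleCentre M ε) (circleRadius M ε))ᶜ =
      {x | 1 * x + -(Complex.I * ε) ≠ 0 ∧
        ((x₀ + ε) * x + -(Complex.I * ε * x₀)) / (1 * x + -(Complex.I * ε)) ∈
          {z : ℂ | z.re < x₀.re + ε + M}} := by
  ext x
  rw [mem_compl_iff, mem_closedBall, not_le, mem_ofPred_eq]
  have hr := circleRadius_pos hM hε
  by_cases hx : x - Complex.I * ε = 0
  · have : x = Complex.I * ε := sub_eq_zero.1 hx
    rw [this, (mem_sphere.1 (I_mul_mem_sphere hM ε))]
    simp
  · rw [homography_eq x₀ x ε hx, one_mul, ← sub_eq_add_neg, mem_ofPred_eq]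
    have key := dist_circleCentre_sq_eq x₀ x hM.ne' ε hx
    have hX : 0 < ‖x - Complex.I * ε‖ ^ 2 := by positivity
    rw [← sq_lt_sq₀ hr.le dist_nonneg, ← sub_pos, ← mul_pos_iff_of_pos_left hM, key,
      mul_pos_iff_of_pos_left hX, sub_pos]
    exact ⟨fun h => ⟨hx, h⟩, fun h => h.2⟩

theorem re_homography_of_mem_sphere (x₀ : ℂ) {M ε : ℝ} (hM : 0 < M) {x : ℂ}
    (hx : x - Complex.I * ε ≠ 0) (hs : x ∈ sphere (circleCentre M ε) (circleRadius M ε)) :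
    (x₀ + ε * x / (x - Complex.I * ε)).re = x₀.re + ε + M := by
  have key := dist_circleCentre_sq_eq x₀ x hM.ne' ε hx
  rw [mem_sphere.1 hs, sub_self, mul_zero] at key
  have hX : ‖x - Complex.I * ε‖ ^ 2 ≠ 0 := by positivity
  have := (mul_eq_zero.1 key.symm).resolve_left hX
  linarith

theorem family_det (x₀ : ℂ) (ε : ℝ) :
    (x₀ + ε) * -(Complex.I * ε) - -(Complex.I * ε * x₀) * 1 = -(Complex.I * (ε : ℂ) ^ 2) := by
  ring

/-- A continuation at p is also one at all nearby points. This reaches iε, which the homography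
sends to infinity. -/
theorem IsSingularBoundaryPoint.of_tendsto {f : ℂ → ℂ} {Ω : Set ℂ} {p : ℂ} {ι : Type*}
    {l : Filter ι} [l.NeBot] {u : ι → ℂ} (hu : Tendsto u l (𝓝 p))
    (h : ∀ᶠ i in l, IsSingularBoundaryPoint f Ω (u i)) : IsSingularBoundaryPoint f Ω p := by
  rintro ⟨g, hg, hgf⟩
  have h₁ := hu.eventually (hg.eventually_analyticAt.and
    (eventually_nhdsWithin_iff.1 hgf).eventually_nhds)
  obtain ⟨i, hi, hga, hge⟩ := (h.and h₁).exists
  exact hi ⟨g, hga, eventually_nhdsWithin_iff.2 hge⟩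

theorem isSingularBoundaryPoint_perturbedFamily {x₀ : ℂ} {Y : ℂ → ℂ} {M ε : ℝ} (hM : 0 < M)
    (hε : ε ≠ 0)
    (hY : ∀ p : ℂ, p.re = x₀.re + ε + M →
      IsSingularBoundaryPoint Y {z | z.re < x₀.re + ε + M} p)
    {p : ℂ} (hp : p ∈ sphere (circleCentre M ε) (circleRadius M ε)) :
    IsSingularBoundaryPoint (perturbedFamily x₀ Y ε)
      (closedBall (circleCentre M ε) (circleRadius M ε))ᶜ p := by
  have hε' : (ε : ℂ) ≠ 0 := by exact_mod_cast hε
  have hdet : (x₀ + ε) * -(Complex.I * ε) - -(Complex.I * ε * x₀) * 1 ≠ 0 := by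
    rw [family_det]
    simpa using hε
  have main : ∀ p : ℂ, p - Complex.I * ε ≠ 0 →
      (x₀ + ε * p / (p - Complex.I * ε)).re = x₀.re + ε + M →
      IsSingularBoundaryPoint (perturbedFamily x₀ Y ε)
        (closedBall (circleCentre M ε) (circleRadius M ε))ᶜ p := by
    intro p hp0 hpre
    rw [compl_closedBall_eq x₀ hM hε]
    refine IsSingularBoundaryPoint.sl2Act hdet (by rwa [one_mul, ← sub_eq_add_neg]) (hY _ ?_)
    rwa [homography_eq x₀ p ε hp0]
  by_cases hp0 : p - Complex.I * ε = 0
  · rw [sub_eq_zero.1 hp0]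
    have hd0 : ∀ s : ℝ, (M : ℂ) + Complex.I * s ≠ 0 := fun s h => by
      have := congrArg Complex.re h
      simp at this
      exact hM.ne' this
    -- Adding iε gives the preimage of x₀ + ε + M + is on the boundary line; it tends to iε as s →
    -- ∞.
    have hlim : Tendsto (fun s : ℝ => Complex.I * (ε : ℂ) ^ 2 * ((M : ℂ) + Complex.I * s)⁻¹)
        atTop (𝓝 0) := by
      have h₁ : Tendsto (fun s : ℝ => (M : ℂ) + Complex.I * s) atTop (Bornology.cobounded ℂ) := by
        rw [← tendsto_norm_atTop_iff_cobounded]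
        refine tendsto_atTop_mono (fun s => ?_) tendsto_id
        calc s ≤ |s| := le_abs_self s
          _ = |((M : ℂ) + Complex.I * s).im| := by simp
          _ ≤ _ := Complex.abs_im_le_norm _
      simpa using (tendsto_inv₀_cobounded.comp h₁).const_mul (Complex.I * (ε : ℂ) ^ 2)
    have hlim' := hlim.const_add (Complex.I * (ε : ℂ))
    rw [add_zero] at hlim'
    refine IsSingularBoundaryPoint.of_tendsto hlim' (Eventually.of_forall fun s => ?_)
    have hX : Complex.I * (ε : ℂ) + Complex.I * (ε : ℂ) ^ 2 * ((M : ℂ) + Complex.I * s)⁻¹ -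
        Complex.I * ε = Complex.I * (ε : ℂ) ^ 2 * ((M : ℂ) + Complex.I * s)⁻¹ := by ring
    have hX0 : Complex.I * (ε : ℂ) ^ 2 * ((M : ℂ) + Complex.I * s)⁻¹ ≠ 0 :=
      mul_ne_zero (mul_ne_zero Complex.I_ne_zero (pow_ne_zero 2 hε')) (inv_ne_zero (hd0 s))
    refine main _ (by rwa [hX]) ?_
    rw [homography_eq' _ _ _ (by rwa [hX]), hX, expansionParam]
    have : -(2 * -(Complex.I * (ε : ℂ) ^ 2 / 2) /
        (Complex.I * (ε : ℂ) ^ 2 * ((M : ℂ) + Complex.I * s)⁻¹)) = (M : ℂ) + Complex.I * s := by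
      have := hd0 s
      have := Complex.I_ne_zero
      field_simp
    rw [this]
    simp
  · exact main p hp0 (re_homography_of_mem_sphere x₀ hM hp0 hp)

theorem eventually_ne_zero_nhdsNE : ∀ᶠ ε : ℝ in 𝓝[≠] (0 : ℝ), ε ≠ 0 := self_mem_nhdsWithin

theorem eventually_lt_nhdsNE_zero {c : ℝ} (hc : 0 < c) : ∀ᶠ ε : ℝ in 𝓝[≠] (0 : ℝ), ε < c :=
  (eventually_lt_nhds hc).filter_mono nhdsWithin_le_nhds

theorem tendsto_circleRadius {m : ℝ} (hm : 0 < m) :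
    Tendsto (fun ε : ℝ => circleRadius (m - ε) ε) (𝓝[≠] (0 : ℝ)) (𝓝 0) := by
  have : ContinuousAt (fun ε : ℝ => ε ^ 2 / (2 * (m - ε))) 0 :=
    ContinuousAt.div (by fun_prop) (by fun_prop) (by simpa using hm.ne')
  have h := this.tendsto
  simp only [ne_eq, OfNat.ofNat_ne_zero, not_false_eq_true, zero_pow, zero_div] at h
  exact h.mono_left nhdsWithin_le_nhds

theorem tendsto_circleCentre {m : ℝ} (hm : 0 < m) :
    Tendsto (fun ε : ℝ => circleCentre (m - ε) ε) (𝓝[≠] (0 : ℝ)) (𝓝 0) := by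
  have hofReal : Tendsto (fun ε : ℝ => (ε : ℂ)) (𝓝[≠] (0 : ℝ)) (𝓝 0) :=
    (Complex.continuous_ofReal.tendsto' 0 0 Complex.ofReal_zero).mono_left nhdsWithin_le_nhds
  have hr : Tendsto (fun ε : ℝ => ((circleRadius (m - ε) ε : ℝ) : ℂ)) (𝓝[≠] (0 : ℝ)) (𝓝 0) :=
    (Complex.continuous_ofReal.tendsto' 0 0 Complex.ofReal_zero).comp (tendsto_circleRadius hm)
  have h := (hofReal.const_mul Complex.I).add (hr.const_mul Complex.I)
  rw [mul_zero, add_zero] at h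
  exact h

/-! ### Expansion and asymptotics at the boundary point iε. -/

theorem re_neg_le_of_mem_expSector {ε δ : ℝ} {x : ℂ} (hx : x ∈ expSector ε δ) :
    (-(2 * expansionParam ε / (x - Complex.I * ε))).re ≤
      -(δ * ‖2 * expansionParam ε / (x - Complex.I * ε)‖) := by
  rw [Complex.neg_re, neg_le_neg_iff]
  exact le_of_lt hx

theorem ne_of_mem_expSector {ε δ : ℝ} {x : ℂ} (hx : x ∈ expSector ε δ) :
    x - Complex.I * ε ≠ 0 := by
  intro h
  rw [expSector, mem_ofPred_eq, h] at hx
  simp at hx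

theorem tendsto_re_expSector {ε δ : ℝ} (hε : ε ≠ 0) (hδ : 0 < δ) :
    Tendsto (fun x : ℂ => (-(2 * expansionParam ε / (x - Complex.I * ε))).re)
      (𝓝[expSector ε δ] (Complex.I * (ε : ℂ))) atBot := by
  have hA : 2 * expansionParam ε ≠ 0 := by simpa [expansionParam] using hε
  have h₁ : Tendsto (fun x : ℂ => x - Complex.I * ε) (𝓝[expSector ε δ] (Complex.I * (ε : ℂ)))
      (𝓝[≠] 0) := by
    refine tendsto_nhdsWithin_iff.2 ⟨?_, ?_⟩
    · have : Tendsto (fun x : ℂ => x - Complex.I * ε) (𝓝 (Complex.I * (ε : ℂ))) (𝓝 0) := by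
        have h : ContinuousAt (fun x : ℂ => x - Complex.I * ε) (Complex.I * (ε : ℂ)) := by fun_prop
        simpa using h.tendsto
      exact this.mono_left nhdsWithin_le_nhds
    · filter_upwards [self_mem_nhdsWithin] with x hx
      exact ne_of_mem_expSector hx
  have h₂ : Tendsto (fun x : ℂ => ‖2 * expansionParam ε / (x - Complex.I * ε)‖)
      (𝓝[expSector ε δ] (Complex.I * (ε : ℂ))) atTop := by
    have := (tendsto_norm_inv_nhdsNE_zero_atTop.comp h₁).const_mul_atTop (norm_pos_iff.2 hA)
    refine this.congr fun x => ?_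
    rw [Function.comp_apply, ← norm_mul, div_eq_mul_inv]
  refine tendsto_atBot_mono' _ ?_ (tendsto_neg_atTop_atBot.comp (h₂.const_mul_atTop hδ))
  filter_upwards [self_mem_nhdsWithin] with x hx
  exact re_neg_le_of_mem_expSector hx

theorem tendsto_exp_expSector {ε δ : ℝ} (hε : ε ≠ 0) (hδ : 0 < δ) :
    Tendsto (fun x : ℂ => Complex.exp (-(2 * expansionParam ε / (x - Complex.I * ε))))
      (𝓝[expSector ε δ] (Complex.I * (ε : ℂ))) (𝓝 0) :=
  tendsto_zero_iff_norm_tendsto_zero.2 (by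
    simp only [Complex.norm_exp]
    exact Real.tendsto_exp_atBot.comp (tendsto_re_expSector hε hδ))

theorem isBigO_eisQ_sub : (fun q => eisQ q - (1 + -24 * q)) =O[𝓝 0] fun q => q ^ 2 := by
  have h := hasFPowerSeriesOnBall_eisQ.hasFPowerSeriesAt.isBigO_sub_partialSum_pow 2
  simp only [zero_add, FormalMultilinearSeries.partialSum, Finset.sum_range_succ,
    Finset.sum_range_zero] at h
  refine (h.congr_left fun q => ?_).trans
    (Asymptotics.IsBigO.of_bound 1 (Eventually.of_forall fun q => by simp))
  simp [eisCoeff, mul_comm]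

theorem IsChazySolutionOn.continuousAt {Y : ℂ → ℂ} {U : Set ℂ} (h : IsChazySolutionOn Y U)
    {x : ℂ} (hx : x ∈ U) : ContinuousAt Y x :=
  (h.2.1.differentiableAt (h.1.mem_nhds hx)).continuousAt

section

variable {b x₀ : ℂ}

theorem perturbedFamily_eisExp_eq (hb : b ≠ 0) {ε : ℝ} {x : ℂ} (hx : x - Complex.I * ε ≠ 0)
    (hre : (x₀ + ε * x / (x - Complex.I * ε)).re < -Real.log ‖b‖) :
    ‖b * Complex.exp (x₀ + ε) *
      Complex.exp (-(2 * expansionParam ε / (x - Complex.I * ε)))‖ < 1 ∧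
    perturbedFamily x₀ (eisExp b) ε x = -6 / (x - Complex.I * ε) +
      expansionParam ε / (x - Complex.I * ε) ^ 2 *
        eisQ (b * Complex.exp (x₀ + ε) *
          Complex.exp (-(2 * expansionParam ε / (x - Complex.I * ε)))) := by
  have e : b * Complex.exp (x₀ + ε * x / (x - Complex.I * ε)) = b * Complex.exp (x₀ + ε) *
      Complex.exp (-(2 * expansionParam ε / (x - Complex.I * ε))) := by
    rw [homography_eq' x₀ x ε hx, Complex.exp_add, mul_assoc]
  refine ⟨e ▸ norm_mul_exp_lt_one hb hre, ?_⟩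
  rw [perturbedFamily_eq x₀ x _ ε hx, eisExp_eq hb hre, e, mul_div_cancel₀ _ two_ne_zero]

theorem isBigO_perturbedFamily_eisExp (hb : b ≠ 0) {ε δ : ℝ} (hε : ε ≠ 0) (hδ : 0 < δ) :
    (fun x : ℂ => perturbedFamily x₀ (eisExp b) ε x -
      (-6 / (x - Complex.I * ε) + expansionParam ε / (x - Complex.I * ε) ^ 2 *
        (1 + -24 * (b * Complex.exp (x₀ + ε)) *
          Complex.exp (-(2 * expansionParam ε / (x - Complex.I * ε))))))
      =O[𝓝[expSector ε δ] (Complex.I * (ε : ℂ))]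
      (fun x : ℂ => ((x - Complex.I * ε) ^ 2)⁻¹ *
        Complex.exp (-(2 * expansionParam ε / (x - Complex.I * ε))) ^ 2) := by
  set c := b * Complex.exp (x₀ + ε) with hc
  have ht := (tendsto_exp_expSector hε hδ).const_mul c
  rw [mul_zero] at ht
  have h₁ := isBigO_eisQ_sub.comp_tendsto ht
  have h₂ : (fun x : ℂ => (c * Complex.exp (-(2 * expansionParam ε / (x - Complex.I * ε)))) ^ 2)
      =O[𝓝[expSector ε δ] (Complex.I * (ε : ℂ))]
      fun x : ℂ => Complex.exp (-(2 * expansionParam ε / (x - Complex.I * ε))) ^ 2 := by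
    simp only [mul_pow]
    exact Asymptotics.isBigO_const_mul_self _ _ _
  have h₃ : (fun x : ℂ => expansionParam ε * ((x - Complex.I * ε) ^ 2)⁻¹)
      =O[𝓝[expSector ε δ] (Complex.I * (ε : ℂ))] fun x : ℂ => ((x - Complex.I * ε) ^ 2)⁻¹ :=
    Asymptotics.isBigO_const_mul_self _ _ _
  refine (h₃.mul (h₁.trans h₂)).congr' ?_ EventuallyEq.rfl
  -- In the sector the real part of -2A/X tends to -∞, so close to iε the homography lands in the
  -- half-plane where the q-series represents the solution.
  filter_upwards [self_mem_nhdsWithin,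
    (tendsto_re_expSector hε hδ).eventually_lt_atBot (-Real.log ‖b‖ - (x₀.re + ε))] with x hx hre
  have hX := ne_of_mem_expSector hx
  have hre' : (x₀ + ε * x / (x - Complex.I * ε)).re < -Real.log ‖b‖ := by
    rw [homography_eq' x₀ x ε hX, Complex.add_re, Complex.add_re, Complex.ofReal_re]
    linarith
  rw [(perturbedFamily_eisExp_eq hb hX hre').2, Function.comp_apply, ← hc]
  ring

theorem hasSum_eisExp_expansion (hb : b ≠ 0) {ε : ℝ} {x : ℂ} (hx : x - Complex.I * ε ≠ 0)
    (hre : (x₀ + ε * x / (x - Complex.I * ε)).re < -Real.log ‖b‖) :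
    ∃ S : ℂ, HasSum (fun n : ℕ => eisCoeff n * (b * Complex.exp (x₀ + ε)) ^ n *
        Complex.exp (-(2 * expansionParam ε / (x - Complex.I * ε))) ^ n) S ∧
      perturbedFamily x₀ (eisExp b) ε x = -6 / (x - Complex.I * ε) +
        expansionParam ε / (x - Complex.I * ε) ^ 2 * S := by
  obtain ⟨h₁, h₂⟩ := perturbedFamily_eisExp_eq hb hx hre
  refine ⟨_, ?_, h₂⟩
  simpa only [mul_pow, mul_assoc] using hasSum_eisQ h₁

end

/-! ### Assembly. -/

theorem IsExpSolution.exists_eisExp_eq {a : ℂ} (ha : a ≠ 0) {w : ℂ → ℂ} (h : IsExpSolution a w) :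
    ∃ ρ : ℝ, ∀ x : ℂ, x.re < -ρ → eisExp (-a / 24) x = halfLogDeriv (expU w) x := by
  have hb : -a / 24 ≠ 0 := div_ne_zero (neg_ne_zero.2 ha) (by norm_num)
  obtain ⟨ρ, hρ⟩ := exists_forall_re_lt_of_eventually
    ((eventually_halfLogDeriv_expU h.1).and h.halfLogDerivQ_eventuallyEq)
  refine ⟨max ρ (Real.log ‖-a / 24‖), fun x hx => ?_⟩
  have h₁ : x.re < -ρ := hx.trans_le (neg_le_neg (le_max_left _ _))
  have h₂ : x.re < -Real.log ‖-a / 24‖ := hx.trans_le (neg_le_neg (le_max_right _ _))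
  rw [eisExp_eq hb h₂, (hρ x h₁).1 x rfl, (hρ x h₁).2]

theorem theorem7 (a : ℂ) :
    -- existence, and uniqueness (as a germ at `0`)
    (∃ w : ℂ → ℂ, IsExpSolution a w) ∧
    (∀ w₁ w₂ : ℂ → ℂ, IsExpSolution a w₁ → IsExpSolution a w₂ → w₁ =ᶠ[𝓝 0] w₂) ∧
    -- for `a ≠ 0`, the solution extends to a half-plane bounded by a natural boundary
    (a ≠ 0 → ∀ w : ℂ → ℂ, IsExpSolution a w →
      ∃ (L : ℝ) (Y : ℂ → ℂ),
        (∃ ρ : ℝ, ∀ x : ℂ, x.re < -ρ → Y x = halfLogDeriv (expU w) x) ∧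
        IsChazySolutionOn Y {x : ℂ | x.re < L} ∧
        IsNaturalBoundary Y {x : ℂ | x.re < L} {x : ℂ | x.re = L} ∧
        ∀ x₀ : ℂ, x₀.re < L →
          -- the family is a perturbation of `-6/x`
          (∀ x : ℂ, perturbedFamily x₀ Y 0 x = -6 / x) ∧
          (∀ δ : ℝ, 0 < δ →
            TendstoUniformlyOn (perturbedFamily x₀ Y) (fun x : ℂ => -6 / x)
              (𝓝[≠] (0 : ℝ)) {x : ℂ | δ ≤ ‖x‖}) ∧
          -- its natural boundary is a circle through `iε`, which shrinks to the point `0`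
          (∃ (c : ℝ → ℂ) (r : ℝ → ℝ),
            Tendsto c (𝓝[≠] (0 : ℝ)) (𝓝 0) ∧ Tendsto r (𝓝[≠] (0 : ℝ)) (𝓝 0) ∧
            ∀ᶠ ε : ℝ in 𝓝[≠] (0 : ℝ),
              0 < r ε ∧
              Complex.I * ε ∈ sphere (c ε) (r ε) ∧
              (0 : ℂ) ∉ closedBall (c ε) (r ε) ∧
              (∀ x ∈ (closedBall (c ε) (r ε))ᶜ, (x₀ + ε * x / (x - Complex.I * ε)).re < L) ∧
              IsChazySolutionOn (perturbedFamily x₀ Y ε) (closedBall (c ε) (r ε))ᶜ ∧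
              IsNaturalBoundary (perturbedFamily x₀ Y ε) (closedBall (c ε) (r ε))ᶜ
                (sphere (c ε) (r ε)) ∧
              -- asymptotics at the boundary: with `X = x - iε` and `A = -iε²/2`,
              -- `y = -6/X + (A/X²) (1 + k₁ exp(-2A/X) + k₂ exp(-4A/X) + ...)`
              ∃ k : ℕ → ℂ, k 0 = 1 ∧ k 1 = a * Complex.exp (x₀ + ε) ∧
                (∀ x ∈ (closedBall (c ε) (r ε))ᶜ, ∃ S : ℂ,
                  HasSum (fun n : ℕ => k n *
                    Complex.exp (-(2 * expansionParam ε / (x - Complex.I * ε))) ^ n) S ∧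
                  perturbedFamily x₀ Y ε x = -6 / (x - Complex.I * ε) +
                    expansionParam ε / (x - Complex.I * ε) ^ 2 * S) ∧
                ∀ δ : ℝ, 0 < δ →
                  (fun x : ℂ => perturbedFamily x₀ Y ε x -
                    (-6 / (x - Complex.I * ε) +
                      expansionParam ε / (x - Complex.I * ε) ^ 2 *
                        (1 + k 1 * Complex.exp
                          (-(2 * expansionParam ε / (x - Complex.I * ε))))))
                  =O[𝓝[expSector ε δ] (Complex.I * (ε : ℂ))]
                  (fun x : ℂ => ((x - Complex.I * ε) ^ 2)⁻¹ *
                    Complex.exp (-(2 * expansionParam ε / (x - Complex.I * ε))) ^ 2)) ∧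
          -- no fixed neighbourhood of `0` on which the solutions exist for small `ε`
          (∀ δ : ℝ, 0 < δ → ∀ᶠ ε : ℝ in 𝓝[≠] (0 : ℝ),
            ¬ ∃ g : ℂ → ℂ, DifferentiableOn ℂ g (ball 0 δ) ∧
              ∀ x ∈ ball (0 : ℂ) δ, (x₀ + ε * x / (x - Complex.I * ε)).re < L →
                x ≠ Complex.I * ε → g x = perturbedFamily x₀ Y ε x) ∧
          -- the limits `ε → 0` and `x → 0` do not commute:
          -- for `x y(x;ε)` the iterated limits are `-6` and `0`
          (∀ x : ℂ, x ≠ 0 →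
            Tendsto (fun ε : ℝ => x * perturbedFamily x₀ Y ε x) (𝓝[≠] 0) (𝓝 (-6))) ∧
          (∀ᶠ ε : ℝ in 𝓝[≠] (0 : ℝ),
            Tendsto (fun x : ℂ => x * perturbedFamily x₀ Y ε x) (𝓝[≠] 0) (𝓝 0))) := by
  refine ⟨exists_isExpSolution a, fun w₁ w₂ h₁ h₂ => h₁.eventuallyEq h₂, fun ha w hw => ?_⟩
  set b := -a / 24 with hbdef
  have hb : b ≠ 0 := div_ne_zero (neg_ne_zero.2 ha) (by norm_num)
  set L := -Real.log ‖b‖ with hLdef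
  have hsol := isChazySolutionOn_eisExp b
  have hsing : ∀ p : ℂ, p.re = L → IsSingularBoundaryPoint (eisExp b) {x | x.re < L} p :=
    fun p hp => isSingularBoundaryPoint_eisExp b hp
  refine ⟨L, eisExp b, hw.exists_eisExp_eq ha, hsol,
    ⟨hsol.1, hsol.2.1, (Complex.frontier_setOfPred_re_lt L).ge, hsing⟩, fun x₀ hx₀ => ?_⟩
  have hcont : ContinuousAt (eisExp b) x₀ := hsol.continuousAt hx₀
  have hm : 0 < L - x₀.re := sub_pos.2 hx₀
  -- The circle parameter M = L - Re x₀ - ε places the boundary line at Re = L; it is positive once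
  -- ε < L - Re x₀.
  have hL : ∀ ε : ℝ, x₀.re + ε + (L - x₀.re - ε) = L := fun ε => by ring
  have hext : ∀ ε : ℝ, ε ≠ 0 → ε < L - x₀.re → ∀ x : ℂ,
      x ∈ (closedBall (circleCentre (L - x₀.re - ε) ε) (circleRadius (L - x₀.re - ε) ε))ᶜ ↔
        x - Complex.I * ε ≠ 0 ∧ (x₀ + ε * x / (x - Complex.I * ε)).re < L := by
    intro ε hε hεm x
    rw [compl_closedBall_eq x₀ (sub_pos.2 hεm) hε, hL, mem_ofPred_eq, one_mul, ← sub_eq_add_neg]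
    refine and_congr_right fun hX => ?_
    have := homography_eq x₀ x ε hX
    rw [one_mul, ← sub_eq_add_neg _ (Complex.I * (ε : ℂ))] at this
    rw [this, mem_ofPred_eq]
  have hchazy : ∀ ε : ℝ, ε ≠ 0 → ε < L - x₀.re → IsChazySolutionOn (perturbedFamily x₀ (eisExp b) ε)
      (closedBall (circleCentre (L - x₀.re - ε) ε) (circleRadius (L - x₀.re - ε) ε))ᶜ := by
    intro ε hε hεm
    rw [compl_closedBall_eq x₀ (sub_pos.2 hεm) hε, hL]
    exact hsol.sl2Act _ _ _ _
  have hfam : ∀ ε : ℝ, ε ≠ 0 → ε < L - x₀.re → ∀ p ∈ sphere (circleCentre (L - x₀.re - ε) ε)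
      (circleRadius (L - x₀.re - ε) ε), IsSingularBoundaryPoint (perturbedFamily x₀ (eisExp b) ε)
      (closedBall (circleCentre (L - x₀.re - ε) ε) (circleRadius (L - x₀.re - ε) ε))ᶜ p :=
    fun ε hε hεm p hp => isSingularBoundaryPoint_perturbedFamily (sub_pos.2 hεm) hε
      (by rw [hL]; exact hsing) hp
  have hzero : ∀ ε : ℝ, ε ≠ 0 → ε < L - x₀.re →
      (0 : ℂ) ∈ (closedBall (circleCentre (L - x₀.re - ε) ε) (circleRadius (L - x₀.re - ε) ε))ᶜ :=
    fun ε hε hεm => (hext ε hε hεm 0).2 ⟨by simpa using hε, by simpa using hx₀⟩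
  refine ⟨fun x => perturbedFamily_zero x₀ x _,
    fun δ hδ => tendstoUniformlyOn_perturbedFamily hcont hδ,
    ⟨fun ε => circleCentre (L - x₀.re - ε) ε, fun ε => circleRadius (L - x₀.re - ε) ε,
      tendsto_circleCentre hm, tendsto_circleRadius hm, ?_⟩, fun δ hδ => ?_,
    fun x hx => tendsto_mul_perturbedFamily hcont hx, ?_⟩
  · filter_upwards [eventually_ne_zero_nhdsNE, eventually_lt_nhdsNE_zero hm] with ε hε hεm
    have hr := circleRadius_pos (sub_pos.2 hεm) hε
    refine ⟨hr, I_mul_mem_sphere (sub_pos.2 hεm) ε, hzero ε hε hεm,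
      fun x hx => ((hext ε hε hεm x).1 hx).2, hchazy ε hε hεm,
      ⟨(hchazy ε hε hεm).1, (hchazy ε hε hεm).2.1, ?_, hfam ε hε hεm⟩,
      fun n => eisCoeff n * (b * Complex.exp (x₀ + ε)) ^ n, by simp [eisCoeff], ?_,
      fun x hx => ?_, fun δ hδ => ?_⟩
    · rw [frontier_compl, frontier_closedBall _ hr.ne']
    -- The coefficient -24 of q in E₂ cancels the factor -1/24 in b.
    · simp [eisCoeff, hbdef]
      ring
    · obtain ⟨h₁, h₂⟩ := (hext ε hε hεm x).1 hx
      exact hasSum_eisExp_expansion hb h₁ h₂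
    · have := isBigO_perturbedFamily_eisExp (x₀ := x₀) hb hε hδ
      simpa [eisCoeff, mul_assoc] using this
  · have hδ' : ∀ᶠ ε : ℝ in 𝓝[≠] (0 : ℝ), |ε| < δ :=
      (continuous_abs.continuousAt.eventually_lt continuousAt_const (by simpa using hδ)).filter_mono
        nhdsWithin_le_nhds
    filter_upwards [eventually_ne_zero_nhdsNE, eventually_lt_nhdsNE_zero hm, hδ'] with ε hε hεm hεδ
    rintro ⟨g, hg, hgf⟩
    have hmem : ball (0 : ℂ) δ ∈ 𝓝 (Complex.I * (ε : ℂ)) :=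
      isOpen_ball.mem_nhds (by simpa using hεδ)
    -- For |ε| < δ the disk contains the boundary point iε, where g would be a forbidden
    -- continuation.
    refine hfam ε hε hεm _ (I_mul_mem_sphere (sub_pos.2 hεm) ε) ⟨g, hg.analyticAt hmem, ?_⟩
    filter_upwards [mem_nhdsWithin_of_mem_nhds hmem, self_mem_nhdsWithin] with x hx hxe
    obtain ⟨h₁, h₂⟩ := (hext ε hε hεm x).1 hxe
    exact hgf x hx h₂ (sub_ne_zero.1 h₁)
  · filter_upwards [eventually_ne_zero_nhdsNE, eventually_lt_nhdsNE_zero hm] with ε hε hεm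
    -- For fixed ε the point 0 lies outside the circle, so the solution is continuous, hence
    -- bounded, near 0.
    have h := ((hchazy ε hε hεm).continuousAt (hzero ε hε hεm)).tendsto
    have h' := (tendsto_id (x := 𝓝 (0 : ℂ))).mul h
    simp only [id, zero_mul] at h'
    exact h'.mono_left nhdsWithin_le_nhds
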